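/- ZX-diagrams $D:n\to m$ are generated by green dots $R_Z^{(n,m)}(\alpha):n\to m$ and red dots $R_X^{(n,m)}(\alpha):n\to m$ (angles modulo $2\pi$), the Hadamard vertex $H:1\to1$, the empty diagram, the wire $\mathbb I$, the crossing $\sigma:2\to2$, the cup $\epsilon:2\to0$ and the cap $\eta:0\to2$, under $\otimes$ and $\circ$. Write $Z^{n,m}_\alpha,X^{n,m}_\alpha$ for the dots, omitting the angle $0$, and write $\lambda=X^{1,0}\circ Z^{0,1}$ and $\mu=X^{3,0}\circ Z^{0,3}$ (scalars standing for $\sqrt2$ and $1/\sqrt2$). Let $ZX\vdash D=E$ be the least congruence (an equivalence relation compatible with $\otimes$ and $\circ$) containing "only topology matters" (compact closed structure, with exchange and bending of legs of dots and sliding of $H$ along bent wires), the following rules, and their colour-swapped and upside-down versions: - (S1) two green dots of angles $\alpha,\beta$ joined by at least one wire merge into one green dot of angle $\alpha+\beta$; - (S2) $Z^{1,1}=\mathbb I$; (S3) $Z^{0,2}=\eta$; - (B1) $\lambda\otimes(Z^{1,2}\circ X^{0,1})=X^{0,1}\otimes X^{0,1}$; - (B2) $\lambda\otimes\big((X^{2,1}\otimes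 X^{2,1})\circ(\mathbb I\otimes\sigma\otimes\mathbb I)\circ(Z^{1,2}\otimes Z^{1,2})\big)=Z^{1,2}\circ X^{2,1}$; - (K1) $Z^{1,2}\circ X^{1,1}_\pi=(X^{1,1}_\pi\otimes X^{1,1}_\pi)\circ Z^{1,2}$; - (K2) $\lambda\otimes(X^{1,1}_\pi\circ Z^{1,1}_\alpha)=(X^{1,0}_\pi\circ Z^{0,1}_\alpha)\otimes(Z^{1,1}_{-\alpha}\circ X^{1,1}_\pi)$; - (EU) $\lambda\otimes H=Z^{0,0}_{-\pi/2}\otimes(Z^{1,1}_{\pi/2}\circ X^{1,1}_{\pi/2}\circ Z^{1,1}_{\pi/2})$; - (H) $H^{\otimes m}\circ Z^{n,m}_\alpha\circ H^{\otimes n}=X^{n,m}_\alpha$; - (IV) $\mu\otimes\lambda=$ the empty diagram; - (ZO) $Z^{0,0}_\pi\otimes\mathbb I=Z^{0,0}_\pi\otimes(X^{0,1}\circ Z^{1,0})$. Theorem. For every angle $\alpha$, the supplementarity equation $$X^{2,1}\circ\big(Z^{0,1}_{\alpha}\otimes Z^{0,1}_{\alpha+\pi}\big)=X^{2,1}\circ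 Z^{0,2}_{2\alpha+\pi}$$ is derivable in the ZX-calculus if and only if $\alpha\equiv0\bmod\frac\pi2$. -/

import Mathlib

namespace ZX

/-- ZX-diagrams with `n` inputs and `m` outputs. Angles are taken modulo `2π`. -/
inductive Diagram : ℕ → ℕ → Type
  /-- the green dot `R_Z^{(n,m)}(α)` -/
  | Z (n m : ℕ) (α : Real.Angle) : Diagram n m
  /-- the red dot `R_X^{(n,m)}(α)` -/
  | X (n m : ℕ) (α : Real.Angle) : Diagram n m
  /-- the Hadamard vertex -/
  | H : Diagram 1 1
  /-- the empty diagram -/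
  | empty : Diagram 0 0
  /-- the plain wire -/
  | wire : Diagram 1 1
  /-- the crossing of two wires -/
  | swap : Diagram 2 2
  /-- the wire `ε` joining two inputs -/
  | eps : Diagram 2 0
  /-- the wire `η` joining two outputs -/
  | eta : Diagram 0 2
  /-- `tensor D₁ D₂` is `D₁ ⊗ D₂`: `D₂` is placed on the right of `D₁` -/
  | tensor {a b c d : ℕ} (D₁ : Diagram a b) (D₂ : Diagram c d) : Diagram (a + c) (b + d)
  /-- `comp D₂ D₁` is `D₂ ∘ D₁`: the outputs of `D₁` are plugged into the inputs of `D₂` -/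
  | comp {a b c : ℕ} (D₂ : Diagram b c) (D₁ : Diagram a b) : Diagram a c

scoped notation:80 D:81 " ⊚ " E:80 => (Diagram.comp D E :)
scoped notation:85 D:86 " ⊠ " E:85 => (Diagram.tensor D E :)

namespace Diagram

/-- Transport of a diagram along equalities of the numbers of inputs and outputs. -/
def cast {a b a' b' : ℕ} (ha : a = a') (hb : b = b') (D : Diagram a b) : Diagram a' b' :=
  ha ▸ hb ▸ D

/-- The colour-swapped version of a diagram: green and red dots are exchanged. -/
def colourSwap : {a b : ℕ} → Diagram a b → Diagram a b
  | _, _, Z n m α => X n m α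
  | _, _, X n m α => Z n m α
  | _, _, H => H
  | _, _, empty => empty
  | _, _, wire => wire
  | _, _, swap => swap
  | _, _, eps => eps
  | _, _, eta => eta
  | _, _, tensor D₁ D₂ => tensor (colourSwap D₁) (colourSwap D₂)
  | _, _, comp D₂ D₁ => comp (colourSwap D₂) (colourSwap D₁)

/-- The upside-down version of a diagram (angles are unchanged). -/
def flip : {a b : ℕ} → Diagram a b → Diagram b a
  | _, _, Z n m α => Z m n α
  | _, _, X n m α => X m n α
  | _, _, H => H
  | _, _, empty => empty
  | _, _, wire => wire
  | _, _, swap => swap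
  | _, _, eps => eta
  | _, _, eta => eps
  | _, _, tensor D₁ D₂ => tensor (flip D₁) (flip D₂)
  | _, _, comp D₂ D₁ => comp (flip D₁) (flip D₂)

/-- `n` parallel wires. -/
def wires : (n : ℕ) → Diagram n n
  | 0 => empty
  | n + 1 => wires n ⊠ wire

/-- `n` parallel Hadamard vertices. -/
def hadamards : (n : ℕ) → Diagram n n
  | 0 => empty
  | n + 1 => hadamards n ⊠ H

/-- The last of `n + 1` wires crosses the other `n` wires and becomes the first one. -/
def slide : (n : ℕ) → Diagram (n + 1) (1 + n)
  | 0 => wire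
  | n + 1 => (slide n ⊠ wire) ⊚ (wires n ⊠ swap)

/-- The scalar made of a green and a red dot of angle `0` joined by one wire; it stands
for `√2`. -/
noncomputable def line : Diagram 0 0 := X 1 0 0 ⊚ Z 0 1 0

/-- The scalar made of a green and a red dot of angle `0` joined by three wires; it stands
for `1/√2`. -/
noncomputable def tripleLine : Diagram 0 0 := X 3 0 0 ⊚ Z 0 3 0

end Diagram

open Diagram

/-- "Only topology matters": the laws of a compact closed category with self-dual objects
(a strict symmetric monoidal category generated by one object, with cups and caps), the exchange
of two legs of a dot, the bending of a leg of a dot, and moving a Hadamard vertex along a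
bent wire. -/
inductive Topology : {a b : ℕ} → Diagram a b → Diagram a b → Prop
  | comp_assoc {a b c d : ℕ} (D₃ : Diagram c d) (D₂ : Diagram b c) (D₁ : Diagram a b) :
      Topology ((D₃ ⊚ D₂) ⊚ D₁) (D₃ ⊚ (D₂ ⊚ D₁))
  | wires_comp {a b : ℕ} (D : Diagram a b) : Topology (wires b ⊚ D) D
  | comp_wires {a b : ℕ} (D : Diagram a b) : Topology (D ⊚ wires a) D
  | interchange {a b c a' b' c' : ℕ} (D₂ : Diagram b c) (D₁ : Diagram a b)
      (E₂ : Diagram b' c') (E₁ : Diagram a' b') :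
      Topology ((D₂ ⊚ D₁) ⊠ (E₂ ⊚ E₁)) ((D₂ ⊠ E₂) ⊚ (D₁ ⊠ E₁))
  | tensor_empty {a b : ℕ} (D : Diagram a b) : Topology (D ⊠ empty) D
  | empty_tensor {a b : ℕ} (D : Diagram a b) :
      Topology ((empty ⊠ D).cast (Nat.zero_add a) (Nat.zero_add b)) D
  | tensor_assoc {a b a' b' a'' b'' : ℕ} (D : Diagram a b) (D' : Diagram a' b')
      (D'' : Diagram a'' b'') :
      Topology (((D ⊠ D') ⊠ D'').cast (Nat.add_assoc a a' a'') (Nat.add_assoc b b' b''))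
        (D ⊠ (D' ⊠ D''))
  | swap_swap : Topology (swap ⊚ swap) (wires 2)
  | slide_natural {a b : ℕ} (D : Diagram a b) :
      Topology (slide b ⊚ (D ⊠ wire)) ((wire ⊠ D) ⊚ slide a)
  | swap_eta : Topology (swap ⊚ eta) eta
  | yanking : Topology ((eps ⊠ wire) ⊚ (wire ⊠ eta)) wire
  | exchange_legs (n a b : ℕ) (α : Real.Angle) :
      Topology ((wires a ⊠ swap ⊠ wires b) ⊚ Z n (a + (2 + b)) α) (Z n (a + (2 + b)) α)
  | bend_leg (n m : ℕ) (α : Real.Angle) :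
      Topology ((Z (n + 1) m α ⊠ wire) ⊚ (wires n ⊠ eta)) (Z n (m + 1) α)
  | bend_H : Topology ((H ⊠ wire) ⊚ eta) ((wire ⊠ H) ⊚ eta)

/-- The basic equations of the ZX-calculus, in one colour and one orientation. -/
inductive Rule : {a b : ℕ} → Diagram a b → Diagram a b → Prop
  | topology {a b : ℕ} {D E : Diagram a b} (h : Topology D E) : Rule D E
  /-- two green dots joined by `k + 1 ≥ 1` wires merge -/
  | S1 (a b c d k : ℕ) (α β : Real.Angle) :
      Rule ((wires b ⊠ Z ((k + 1) + c) d β) ⊚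
          (Z a (b + (k + 1)) α ⊠ wires c).cast rfl (Nat.add_assoc b (k + 1) c))
        (Z (a + c) (b + d) (α + β))
  | S2 : Rule (Z 1 1 0) wire
  | S3 : Rule (Z 0 2 0) eta
  /-- copy -/
  | B1 : Rule (line ⊠ (Z 1 2 0 ⊚ X 0 1 0)) (X 0 1 0 ⊠ X 0 1 0)
  /-- bialgebra -/
  | B2 : Rule
      (line ⊠ ((X 2 1 0 ⊠ X 2 1 0) ⊚ (wire ⊠ swap ⊠ wire) ⊚ (Z 1 2 0 ⊠ Z 1 2 0)))
      (Z 1 2 0 ⊚ X 2 1 0)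
  /-- `π`-copy -/
  | K1 : Rule (Z 1 2 0 ⊚ X 1 1 (Real.pi : ℝ))
      ((X 1 1 (Real.pi : ℝ) ⊠ X 1 1 (Real.pi : ℝ)) ⊚ Z 1 2 0)
  /-- `π`-commutation -/
  | K2 (α : Real.Angle) : Rule (line ⊠ (X 1 1 (Real.pi : ℝ) ⊚ Z 1 1 α))
      ((X 1 0 (Real.pi : ℝ) ⊚ Z 0 1 α) ⊠ (Z 1 1 (-α) ⊚ X 1 1 (Real.pi : ℝ)))
  /-- Euler decomposition of the Hadamard vertex -/
  | EU : Rule (line ⊠ H)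
      (Z 0 0 (-(Real.pi / 2) : ℝ) ⊠
        (Z 1 1 (Real.pi / 2 : ℝ) ⊚ X 1 1 (Real.pi / 2 : ℝ) ⊚ Z 1 1 (Real.pi / 2 : ℝ)))
  /-- colour change -/
  | H (n m : ℕ) (α : Real.Angle) : Rule (hadamards m ⊚ Z n m α ⊚ hadamards n) (X n m α)
  /-- inverse -/
  | IV : Rule (tripleLine ⊠ line) empty
  /-- zero -/
  | ZO : Rule (Z 0 0 (Real.pi : ℝ) ⊠ wire) (Z 0 0 (Real.pi : ℝ) ⊠ (X 0 1 0 ⊚ Z 1 0 0))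

/-- `Derivable D E` means `ZX ⊢ D = E`: the least congruence that contains the basic equations,
their colour-swapped and upside-down versions. -/
inductive Derivable : {a b : ℕ} → Diagram a b → Diagram a b → Prop
  | rule {a b : ℕ} {D E : Diagram a b} (h : Rule D E) : Derivable D E
  | rule_swapped {a b : ℕ} {D E : Diagram a b} (h : Rule D E) :
      Derivable D.colourSwap E.colourSwap
  | rule_flipped {a b : ℕ} {D E : Diagram a b} (h : Rule D E) : Derivable D.flip E.flip
  | rule_swapped_flipped {a b : ℕ} {D E : Diagram a b} (h : Rule D E) :
      Derivable D.colourSwap.flip E.colourSwap.flip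
  | refl {a b : ℕ} (D : Diagram a b) : Derivable D D
  | symm {a b : ℕ} {D E : Diagram a b} : Derivable D E → Derivable E D
  | trans {a b : ℕ} {D E F : Diagram a b} : Derivable D E → Derivable E F → Derivable D F
  | tensor {a b c d : ℕ} {D D' : Diagram a b} {E E' : Diagram c d} :
      Derivable D D' → Derivable E E' → Derivable (D ⊠ E) (D' ⊠ E')
  | comp {a b c : ℕ} {D D' : Diagram b c} {E E' : Diagram a b} :
      Derivable D D' → Derivable E E' → Derivable (D ⊚ E) (D' ⊚ E')

/-- Left-hand side of supplementarity: green dots of angles `α` and `α + π`, each joined by one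
wire to a red dot of angle `0` with one output. -/
noncomputable def suppLeft (α : Real.Angle) : Diagram 0 1 :=
  X 2 1 0 ⊚ (Z 0 1 α ⊠ Z 0 1 (α + (Real.pi : ℝ)))

/-- Right-hand side of supplementarity: one green dot of angle `2α + π` joined by two wires to
a red dot of angle `0` with one output. -/
noncomputable def suppRight (α : Real.Angle) : Diagram 0 1 :=
  X 2 1 0 ⊚ Z 0 2 (α + α + (Real.pi : ℝ))

end ZX

/-! Only if: a nonstandard model refutes the equation at every other angle. A wire carries three
bits, and a green dot of angle `α` multiplies the basis vector `g` by `exp(iα · wt g)`, where `wt g`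
is the number of ones modulo 4, represented by `0, 1, -2, -1`. At multiples of `π/2` only the class
modulo 4 matters, so there the model is the threefold tensor power of the usual one and (EU) holds.
For free angles, (S1) needs the phase to be additive in `α`, and (K2) needs `wt 1 - wt (x + 1) = wt
x`; both survive this choice of representatives. Red dots are Hadamard conjugates of green ones, so
swapping colours is conjugation (`ev_colourSwap`) and turning upside down is transposition
(`ev_flip`); each rule is therefore checked in one version only (`sound_rule`). At the output `(1,
1, 0)` the right-hand side of supplementarity vanishes, while the left-hand side is a nonzero
multiple of `(1 + b²)(1 - b⁴)` with `b = exp(iα)`. Hence `b⁴ = 1`.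

If: adding `π` to `α` merely exchanges the two green dots, so `α = 0` and `α = π/2` suffice. For `α
= 0` both sides become multiples of the scalar `Z^{0,0}_π`: the left by copying a green state
through the red dot (`x_merge_z`), the right by the Hopf law (`hopf`). Rule (ZO) then identifies the
remaining states and absorbs the surplus powers of `√2`. For `α = π/2`, (EU) makes the green states
of angle `±π/2` proportional to the red states of angle `∓π/2` (`x_state_eq`, `z_state_eq`), and the
red dot adds their angles. -/

namespace ZX

open Diagram

/-! ### Matrices indexed by words -/

section Words

set_option linter.unusedSectionVars false

variable {G : Type} [Fintype G] [DecidableEq G]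

/-- Matrices from words of length `a` to words of length `b`. -/
abbrev WMat (G : Type) (b a : ℕ) := Matrix (Fin b → G) (Fin a → G) ℂ

/-- The Kronecker product of two matrices on words. -/
def kron {a b c d : ℕ} (M : WMat G b a) (N : WMat G d c) : WMat G (b + d) (a + c) :=
  fun y x => M (fun i => y (Fin.castAdd d i)) (fun i => x (Fin.castAdd c i)) *
    N (fun i => y (Fin.natAdd b i)) (fun i => x (Fin.natAdd a i))

/-- The tensor power of a matrix. -/
def power (M : Matrix G G ℂ) (n : ℕ) : WMat G n n := fun y x => ∏ i, M (y i) (x i)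

/-- The spider with weights `f` whose outputs carry `B` and whose inputs carry `C`. -/
def spider (f : G → ℂ) (B C : Matrix G G ℂ) (n m : ℕ) : WMat G m n :=
  fun y x => ∑ g, f g * (∏ j, B (y j) g) * ∏ i, C (x i) g

/-- The matrix that rearranges the letters of a word. -/
def rewire {a b : ℕ} (e : Fin b → Fin a) : WMat G b a :=
  fun y x => if y = (fun i => x (e i)) then 1 else 0

theorem sum_words_add {a b : ℕ} (F : (Fin (a + b) → G) → ℂ) :
    ∑ z, F z = ∑ u : Fin a → G, ∑ v : Fin b → G, F (Fin.append u v) := by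
  rw [← (Fin.appendEquiv a b).sum_comp, Fintype.sum_prod_type]
  rfl

theorem sum_words_succ {n : ℕ} (F : (Fin (n + 1) → G) → ℂ) :
    ∑ z, F z = ∑ g : G, ∑ z : Fin n → G, F (Fin.cons g z) := by
  rw [← (Fin.consEquiv fun _ : Fin (n + 1) => G).sum_comp, Fintype.sum_prod_type]
  rfl

theorem kron_mul {a b c a' b' c' : ℕ} (M₂ : WMat G c b) (M₁ : WMat G b a) (N₂ : WMat G c' b')
    (N₁ : WMat G b' a') : kron (M₂ * M₁) (N₂ * N₁) = kron M₂ N₂ * kron M₁ N₁ := by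
  ext y x
  simp only [kron, Matrix.mul_apply, sum_words_add, Fin.append_left, Fin.append_right,
    Finset.sum_mul_sum]
  refine Finset.sum_congr rfl fun u _ => Finset.sum_congr rfl fun v _ => ?_
  ring

theorem kron_transpose {a b c d : ℕ} (M : WMat G b a) (N : WMat G d c) :
    (kron M N).transpose = kron M.transpose N.transpose := rfl

theorem power_mul (M N : Matrix G G ℂ) (n : ℕ) : power M n * power N n = power (M * N) n := by
  ext y x
  simp only [power, Matrix.mul_apply, ← Finset.prod_mul_distrib]
  exact (Fintype.prod_sum fun i z => M (y i) z * N z (x i)).symm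

theorem power_one (n : ℕ) : power (1 : Matrix G G ℂ) n = 1 := by
  ext y x
  simp only [power, Matrix.one_apply, Finset.prod_ite_zero, Finset.prod_const_one,
    Finset.mem_univ, true_implies, funext_iff]

theorem power_add (M : Matrix G G ℂ) (m n : ℕ) : power M (m + n) = kron (power M m) (power M n) := by
  ext y x
  simp only [power, kron, Fin.prod_univ_add]

/-- The legs of a spider are independent once its colour `g` is fixed, so a matrix on every leg is
absorbed leg by leg. -/
theorem power_mul_spider (M B C : Matrix G G ℂ) (f : G → ℂ) (n m : ℕ) :
    power M m * spider f B C n m = spider f (M * B) C n m := by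
  ext y x
  simp only [power, spider, Matrix.mul_apply, Finset.mul_sum]
  rw [Finset.sum_comm]
  refine Finset.sum_congr rfl fun g _ => ?_
  rw [Fintype.prod_sum, Finset.mul_sum, Finset.sum_mul]
  refine Finset.sum_congr rfl fun z _ => ?_
  rw [Finset.prod_mul_distrib]
  ring

theorem spider_transpose (B C : Matrix G G ℂ) (f : G → ℂ) (n m : ℕ) :
    (spider f B C n m).transpose = spider f C B m n := by
  ext y x
  simp only [spider, Matrix.transpose_apply]
  exact Finset.sum_congr rfl fun g _ => by ring

theorem power_transpose (M : Matrix G G ℂ) (n : ℕ) :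
    (power M n).transpose = power M.transpose n := rfl

theorem spider_mul_power (M B C : Matrix G G ℂ) (f : G → ℂ) (n m : ℕ) :
    spider f B C n m * power M n = spider f B (M.transpose * C) n m := by
  rw [← Matrix.transpose_transpose (spider f B C n m * power M n), Matrix.transpose_mul,
    spider_transpose, power_transpose, power_mul_spider, spider_transpose]

theorem mul_rewire {a b c : ℕ} (M : WMat G c b) (e : Fin b → Fin a) (y : Fin c → G)
    (x : Fin a → G) : (M * (rewire e : WMat G b a) : WMat G c a) y x = M y fun i => x (e i) := by
  simp [Matrix.mul_apply, rewire]

theorem rewire_mul_rewire {a b c : ℕ} (e : Fin b → Fin a) (f : Fin c → Fin b) :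
    ((rewire f : WMat G c b) * (rewire e : WMat G b a) : WMat G c a) = rewire fun i => e (f i) := by
  ext y x
  rw [mul_rewire]
  rfl

theorem rewire_id (n : ℕ) : (rewire (fun i => i) : WMat G n n) = 1 := by
  ext y x
  simp [rewire, Matrix.one_apply]

theorem words_add_ext {a b : ℕ} {y z : Fin (a + b) → G} :
    y = z ↔ (fun i => y (Fin.castAdd b i)) = (fun i => z (Fin.castAdd b i)) ∧
      (fun i => y (Fin.natAdd a i)) = fun i => z (Fin.natAdd a i) := by
  simp only [funext_iff]
  exact ⟨fun h => ⟨fun i => h _, fun i => h _⟩, fun h => Fin.addCases h.1 h.2⟩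

theorem kron_rewire {a b c d : ℕ} (e : Fin b → Fin a) (f : Fin d → Fin c) :
    (kron (rewire e) (rewire f) : WMat G (b + d) (a + c)) =
      rewire (Fin.addCases (fun i => Fin.castAdd c (e i)) fun i => Fin.natAdd a (f i)) := by
  ext y x
  simp only [kron, rewire, words_add_ext (y := y), Fin.addCases_left, Fin.addCases_right,
    ite_and, mul_ite, mul_one, mul_zero]
  split_ifs <;> rfl

theorem kron_one (m n : ℕ) : (kron 1 1 : WMat G (m + n) (m + n)) = 1 := by
  rw [← power_one, ← power_one, ← power_add, power_one]

theorem rewire_equiv_mul {a b c : ℕ} (e : Fin c ≃ Fin b) (M : WMat G b a) (y : Fin c → G)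
    (x : Fin a → G) : ((rewire e : WMat G c b) * M : WMat G c a) y x = M (fun i => y (e.symm i)) x := by
  rw [Matrix.mul_apply, Finset.sum_eq_single (fun i => y (e.symm i))]
  · simp [rewire]
  · rintro z - hz
    rw [rewire, if_neg, zero_mul]
    rintro rfl
    exact hz (by simp)
  · simp

theorem rewire_mul_spider {n a b : ℕ} (e : Fin b ≃ Fin a) (f : G → ℂ) (B C : Matrix G G ℂ) :
    ((rewire e : WMat G b a) * spider f B C n a : WMat G b n) = spider f B C n b := by
  ext y x
  rw [rewire_equiv_mul]
  simp only [spider]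
  refine Finset.sum_congr rfl fun g _ => ?_
  rw [e.symm.prod_comp fun j => B (y j) g]

theorem power_mul_rewire {n : ℕ} (M : Matrix G G ℂ) (e : Fin n ≃ Fin n) :
    power M n * (rewire e : WMat G n n) = (rewire e : WMat G n n) * power M n := by
  ext y x
  rw [mul_rewire, rewire_equiv_mul]
  simp only [power]
  rw [← e.prod_comp fun i => M (y (e.symm i)) (x i)]
  simp

theorem spider_one_apply (f : G → ℂ) (n m : ℕ) (y : Fin m → G) (x : Fin n → G) :
    spider f 1 1 n m y x =
      ∑ g, f g * (if y = fun _ => g then 1 else 0) * if x = fun _ => g then 1 else 0 := by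
  simp only [spider, Matrix.one_apply, Finset.prod_ite_zero, Finset.prod_const_one,
    Finset.mem_univ, true_implies, funext_iff]

theorem one_kron_mul_apply {a b c d : ℕ} (M : WMat G d c) (N : WMat G (b + c) a)
    (y : Fin (b + d) → G) (x : Fin a → G) :
    ((kron (1 : WMat G b b) M : WMat G (b + d) (b + c)) * N : WMat G (b + d) a) y x = ∑ v, M (fun i => y (Fin.natAdd b i)) v *
      N (Fin.append (fun i => y (Fin.castAdd d i)) v) x := by
  rw [Matrix.mul_apply, sum_words_add, Finset.sum_eq_single fun i => y (Fin.castAdd d i)]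
  · simp only [kron, Matrix.one_apply, Fin.append_left, Fin.append_right, if_true, one_mul]
  · intro u _ hu
    refine Finset.sum_eq_zero fun v _ => ?_
    simp only [kron, Matrix.one_apply, Fin.append_left, Fin.append_right, if_neg (Ne.symm hu), zero_mul]
  · simp

theorem kron_one_mul_apply {a b c d : ℕ} (M : WMat G d c) (N : WMat G (c + b) a)
    (y : Fin (d + b) → G) (x : Fin a → G) :
    ((kron M (1 : WMat G b b) : WMat G (d + b) (c + b)) * N : WMat G (d + b) a) y x = ∑ v, M (fun i => y (Fin.castAdd b i)) v *
      N (Fin.append v (fun i => y (Fin.natAdd d i))) x := by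
  rw [Matrix.mul_apply, sum_words_add]
  refine Finset.sum_congr rfl fun v _ => ?_
  rw [Finset.sum_eq_single fun i => y (Fin.natAdd d i)]
  · simp only [kron, Matrix.one_apply, Fin.append_left, Fin.append_right, if_true, mul_one]
  · intro u _ hu
    simp only [kron, Matrix.one_apply, Fin.append_left, Fin.append_right, if_neg (Ne.symm hu), zero_mul,
      mul_zero]
  · simp

theorem append_eq_const {a b : ℕ} (u : Fin a → G) (v : Fin b → G) (g : G) :
    (Fin.append u v = fun _ => g) ↔ (u = fun _ => g) ∧ v = fun _ => g := by
  rw [words_add_ext]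
  simp only [Fin.append_left, Fin.append_right]

theorem word_eq_const {a b : ℕ} (y : Fin (a + b) → G) (g : G) :
    (y = fun _ => g) ↔ ((fun i => y (Fin.castAdd b i)) = fun _ => g) ∧
      (fun i => y (Fin.natAdd a i)) = fun _ => g :=
  words_add_ext

/-- A constant word with at least one letter determines that letter; this is where fusion needs a
joining wire. -/
theorem sum_const_words (k : ℕ) (A B : G → ℂ) :
    ∑ v : Fin (k + 1) → G, (∑ g, if v = (fun _ => g) then A g else 0) *
      (∑ g, if v = (fun _ => g) then B g else 0) = ∑ g, A g * B g := by
  simp only [Finset.sum_mul, ite_mul, zero_mul]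
  rw [Finset.sum_comm]
  simp only [Finset.sum_ite_eq', Finset.mem_univ, if_true]
  have hinj : ∀ g g' : G, ((fun _ : Fin (k + 1) => g) = fun _ => g') ↔ g = g' :=
    fun g g' => ⟨fun h => congrFun h 0, fun h => by rw [h]⟩
  simp only [hinj, Finset.sum_ite_eq, Finset.mem_univ, if_true]

/-- The joining wires force both spiders to carry the same letter, so the weights multiply. `N` is
given through its values because regrouping the word lengths involves a cast. -/
theorem spider_fusion (f f' : G → ℂ) (a b c d k : ℕ) (N : WMat G (b + ((k + 1) + c)) (a + c))
    (hN : ∀ u v w x, N (Fin.append u (Fin.append v w)) x =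
      kron (spider f 1 1 a (b + (k + 1))) (1 : WMat G c c) (Fin.append (Fin.append u v) w) x) :
    (kron (1 : WMat G b b) (spider f' 1 1 ((k + 1) + c) d) * N : WMat G (b + d) (a + c)) =
      spider (fun g => f g * f' g) 1 1 (a + c) (b + d) := by
  ext y x
  rw [one_kron_mul_apply, sum_words_add]
  simp only [hN, kron, Fin.append_left, Fin.append_right, spider_one_apply, append_eq_const,
    word_eq_const y, word_eq_const x, Matrix.one_apply, mul_ite, mul_one, mul_zero, ite_and,
    Finset.sum_ite_eq', Finset.mem_univ, if_true]
  refine Eq.trans (Finset.sum_congr rfl fun v _ => ?_) ((sum_const_words k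
    (fun g => if (fun i => x (Fin.natAdd a i)) = (fun _ => g) then
      if (fun i => y (Fin.natAdd b i)) = (fun _ => g) then f' g else 0 else 0)
    (fun g => if (fun i => x (Fin.castAdd c i)) = (fun _ => g) then
      if (fun i => y (Fin.castAdd d i)) = (fun _ => g) then f g else 0 else 0)).trans ?_)
  · congr 1
    refine Finset.sum_congr rfl fun g _ => ?_
    split_ifs <;> rfl
  · refine Finset.sum_congr rfl fun g _ => ?_
    split_ifs <;> ring

end Words
/-! ### The model -/

/-- Triples of bits. -/
abbrev Bits : Type := ZMod 2 × ZMod 2 × ZMod 2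

/-- The weight of a triple of bits, which is the number of ones modulo `4`. -/
def wt (g : Bits) : ℤ :=
  if g.1.val + g.2.1.val + g.2.2.val ≤ 1 then g.1.val + g.2.1.val + g.2.2.val
  else g.1.val + g.2.1.val + g.2.2.val - 4

/-- The sign character of `ZMod 2`. -/
def bitSign (a : ZMod 2) : ℤ := if a = 0 then 1 else -1

/-- The bicharacter of the group of triples of bits. -/
def chi (g s : Bits) : ℤ :=
  bitSign (g.1 * s.1) * bitSign (g.2.1 * s.2.1) * bitSign (g.2.2 * s.2.2)

/-- The one property of the representatives of `wt` on which (K2) depends. -/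
theorem wt_compl (x : Bits) : wt 1 - wt (x + 1) = wt x := by
  revert x; decide

theorem chi_comm (x y : Bits) : chi x y = chi y x := by
  revert x y; decide

theorem chi_zero (x : Bits) : chi x 0 = 1 := by
  revert x; decide

theorem bitSign_add : ∀ a b : ZMod 2, bitSign (a + b) = bitSign a * bitSign b := by
  decide

theorem chi_add (g s t : Bits) : chi g (s + t) = chi g s * chi g t := by
  simp only [chi, Prod.fst_add, Prod.snd_add, mul_add, bitSign_add]
  ring

theorem sum_chi (s : Bits) : ∑ g, chi g s = if s = 0 then 8 else 0 := by
  revert s; decide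

/-- The square root of `8`. -/
noncomputable def rt : ℂ := (Real.sqrt 8 : ℝ)

theorem rt_mul_rt : rt * rt = 8 := by
  rw [rt, ← Complex.ofReal_mul, Real.mul_self_sqrt (by norm_num)]
  norm_num

theorem rt_ne_zero : rt ≠ 0 := by
  intro h
  have := rt_mul_rt
  rw [h] at this
  norm_num at this

/-- The Hadamard matrix of the group of triples of bits. -/
noncomputable def had : Matrix Bits Bits ℂ := fun x y => chi x y / rt

/-- The phase of a green dot on a basis vector. -/
noncomputable def phase (α : Real.Angle) (g : Bits) : ℂ := (α.toCircle : ℂ) ^ wt g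

/-- Orthogonality of characters; in characteristic two `x = y` is the same as `x + y = 0`. -/
theorem had_mul_had : had * had = 1 := by
  ext x y
  have h : ∀ z, had x z * had z y = ((chi z (x + y) : ℤ) : ℂ) / 8 := by
    intro z
    rw [had, had, chi_add, chi_comm x z, ← rt_mul_rt]
    push_cast
    field_simp
  have h2 : ∀ x y : Bits, x + y = 0 ↔ x = y := by decide
  simp only [Matrix.mul_apply, h, ← Finset.sum_div]
  rw [← Int.cast_sum, sum_chi, Matrix.one_apply]
  simp only [h2]
  split_ifs <;> simp

theorem had_transpose : had.transpose = had := by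
  ext x y
  simp only [Matrix.transpose_apply, had, chi_comm]

theorem phase_zero (g : Bits) : phase 0 g = 1 := by
  simp [phase]

theorem phase_add (α β : Real.Angle) (g : Bits) : phase (α + β) g = phase α g * phase β g := by
  simp [phase, mul_zpow]

/-- The interpretation of a diagram, where every wire carries three bits. -/
noncomputable def ev : {a b : ℕ} → Diagram a b → WMat Bits b a
  | _, _, Z n m α => spider (phase α) 1 1 n m
  | _, _, X n m α => spider (phase α) had had n m
  | _, _, H => power had 1
  | _, _, empty => 1
  | _, _, wire => 1
  | _, _, swap => rewire (Equiv.swap (0 : Fin 2) 1)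
  | _, _, eps => spider (phase 0) 1 1 2 0
  | _, _, eta => spider (phase 0) 1 1 0 2
  | _, _, tensor D E => kron (ev D) (ev E)
  | _, _, comp D E => ev D * ev E

/-! ### Symmetries of the model and soundness of the topological rules -/

theorem ev_cast {a b a' b' : ℕ} (ha : a = a') (hb : b = b') (D : Diagram a b) (y : Fin b' → Bits)
    (x : Fin a' → Bits) : ev (D.cast ha hb) y x =
      ev D (fun i => y (Fin.cast hb i)) (fun i => x (Fin.cast ha i)) := by
  subst ha hb
  rfl

theorem ev_wires (n : ℕ) : ev (wires n) = 1 := by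
  induction n with
  | zero => rfl
  | succ n ih =>
    rw [wires, ev, ih, ev]
    exact kron_one n 1

theorem ev_hadamards (n : ℕ) : ev (hadamards n) = power had n := by
  induction n with
  | zero => rw [hadamards, ev, ← power_one]; rfl
  | succ n ih => rw [hadamards, ev, ih, ev, power_add]

theorem ev_flip {a b : ℕ} (D : Diagram a b) : ev D.flip = (ev D).transpose := by
  induction D with
  | Z | X => simp only [Diagram.flip, ev, spider_transpose]
  | H =>
    simp only [Diagram.flip, ev, power_transpose, had_transpose]
  | empty | wire => simp only [Diagram.flip, ev, Matrix.transpose_one]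
  | swap =>
    simp only [Diagram.flip, ev]
    ext y x
    simp only [rewire, Matrix.transpose_apply, funext_iff, Fin.forall_fin_two, Equiv.swap_apply_left,
      Equiv.swap_apply_right]
    congr 1
    exact propext ⟨fun h => ⟨h.2.symm, h.1.symm⟩, fun h => ⟨h.2.symm, h.1.symm⟩⟩
  | eps | eta => simp only [Diagram.flip, ev, spider_transpose]
  | tensor D E hD hE => simp only [Diagram.flip, ev, hD, hE, kron_transpose]
  | comp D E hD hE => simp only [Diagram.flip, ev, hD, hE, Matrix.transpose_mul]

theorem power_had_mul (n : ℕ) : power had n * power had n = 1 := by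
  rw [power_mul, had_mul_had, power_one]

theorem had_spider_had (f : Bits → ℂ) (n m : ℕ) :
    power had m * spider f 1 1 n m * power had n = spider f had had n m := by
  rw [power_mul_spider, spider_mul_power, had_transpose, mul_one]

theorem had_spider_had' (f : Bits → ℂ) (n m : ℕ) :
    power had m * spider f had had n m * power had n = spider f 1 1 n m := by
  rw [power_mul_spider, spider_mul_power, had_transpose, had_mul_had]

/-- Bent wires have no colour: `had` is symmetric and squares to one. -/
theorem spider_phase_zero_two :
    spider (phase 0) had had 2 0 = (spider (phase 0) 1 1 2 0 : WMat Bits 0 2) := by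
  have key : ∀ B : Matrix Bits Bits ℂ, ∀ y x, spider (phase 0) B B 2 0 y x =
      (B * B.transpose) (x 0) (x 1) := by
    intro B y x
    simp only [spider, phase_zero, Fin.prod_univ_two, Finset.univ_eq_empty, Finset.prod_empty,
      one_mul, Matrix.mul_apply, Matrix.transpose_apply]
  ext y x
  rw [key, key, had_transpose, had_mul_had, Matrix.transpose_one, one_mul]

/-- Conjugation by Hadamards is functorial, since those between composed diagrams cancel in pairs.
-/
theorem ev_colourSwap {a b : ℕ} (D : Diagram a b) :
    ev D.colourSwap = power had b * ev D * power had a := by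
  induction D with
  | Z => simp only [Diagram.colourSwap, ev, had_spider_had]
  | X => simp only [Diagram.colourSwap, ev, had_spider_had']
  | H => simp only [Diagram.colourSwap, ev, power_had_mul, one_mul]
  | empty =>
    simp only [Diagram.colourSwap, ev, mul_one, power_had_mul]
  | wire => simp only [Diagram.colourSwap, ev, mul_one, power_had_mul]
  | swap =>
    simp only [Diagram.colourSwap, ev]
    rw [power_mul_rewire, Matrix.mul_assoc, power_had_mul, mul_one]
  | eps =>
    simp only [Diagram.colourSwap, ev, had_spider_had, spider_phase_zero_two]
  | eta =>
    simp only [Diagram.colourSwap, ev, had_spider_had]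
    rw [← Matrix.transpose_inj, spider_transpose, spider_transpose, spider_phase_zero_two]
  | tensor D E hD hE =>
    simp only [Diagram.colourSwap, ev, hD, hE, power_add, kron_mul]
  | @comp a b c D E hD hE =>
    simp only [Diagram.colourSwap, ev, hD, hE]
    simp only [Matrix.mul_assoc]
    rw [← Matrix.mul_assoc (power had b) (power had b), power_had_mul, Matrix.one_mul]

theorem ev_comp {a b c : ℕ} (D : Diagram b c) (E : Diagram a b) : ev (D ⊚ E) = ev D * ev E :=
  rfl

theorem ev_tensor {a b c d : ℕ} (D : Diagram a b) (E : Diagram c d) :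
    ev (D ⊠ E) = kron (ev D) (ev E) :=
  rfl

theorem eta_apply (y : Fin 2 → Bits) (x : Fin 0 → Bits) :
    spider (phase 0) 1 1 0 2 y x = if y 0 = y 1 then 1 else 0 := by
  simp only [spider, phase_zero, Fin.prod_univ_two, Finset.univ_eq_empty, Finset.prod_empty,
      one_mul, mul_one, Matrix.one_apply, ite_mul, zero_mul, Finset.sum_ite_eq, Finset.mem_univ,
      if_true]
  simp only [eq_comm]

theorem spider_bend (f : Bits → ℂ) (n m : ℕ) :
    (kron (spider f 1 1 (n + 1) m) (1 : WMat Bits 1 1) : WMat Bits (m + 1) (n + 1 + 1)) *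
      (kron (1 : WMat Bits n n) (spider (phase 0) 1 1 0 2) : WMat Bits (n + 2) n) =
    spider f 1 1 n (m + 1) := by
  ext (y : Fin (m + 1) → Bits) (x : Fin n → Bits)
  rw [kron_one_mul_apply, sum_words_add]
  -- The same word is split as `n + 2` by one factor and as `(n + 1) + 1` by the other; `z` mediates
  -- between the two.
  have h1 : ∀ (u : Fin n → Bits) (w t : Fin 1 → Bits) (z : Fin (n + 2) → Bits),
      z = (Fin.append (Fin.append u w) t : Fin (n + 1 + 1) → Bits) →
      (kron (1 : WMat Bits n n) (spider (phase 0) 1 1 0 2) : WMat Bits (n + 2) n) z x =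
        if u = x then (if w = t then 1 else 0) else 0 := by
    intro u w t z hz
    have e1 : (fun i : Fin n => z (Fin.castAdd 2 i)) = u := by
      funext i
      have : (Fin.castAdd 2 i : Fin (n + 1 + 1)) = Fin.castAdd 1 (Fin.castAdd 1 i) := rfl
      rw [hz, this, Fin.append_left, Fin.append_left]
    have e2 : z (Fin.natAdd n (0 : Fin 2)) = w 0 := by
      have : (Fin.natAdd n (0 : Fin 2) : Fin (n + 1 + 1)) = Fin.castAdd 1 (Fin.natAdd n 0) := rfl
      rw [hz, this, Fin.append_left, Fin.append_right]
    have e3 : z (Fin.natAdd n (1 : Fin 2)) = t 0 := by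
      have : (Fin.natAdd n (1 : Fin 2) : Fin (n + 1 + 1)) = Fin.natAdd (n + 1) (0 : Fin 1) := rfl
      rw [hz, this, Fin.append_right]
    have e4 : w = t ↔ w 0 = t 0 :=
      ⟨fun h => by rw [h], fun h => funext fun i => by rw [Subsingleton.elim i 0, h]⟩
    rw [kron, eta_apply, e1, e2, e3, Matrix.one_apply]
    simp only [e4, ite_mul, one_mul, zero_mul]
    rfl
  refine (Finset.sum_congr rfl fun u _ => Finset.sum_congr rfl fun w _ =>
    congrArg _ (h1 u w _ _ rfl)).trans ?_
  simp only [mul_ite, mul_one, mul_zero]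
  rw [Finset.sum_eq_single x (fun u _ hu => Finset.sum_eq_zero fun w _ => if_neg hu) (by simp)]
  simp only [if_true, Finset.sum_ite_eq', Finset.mem_univ]
  simp only [spider, Matrix.one_apply, Fin.prod_univ_add, Fin.append_left, Fin.append_right]
  exact Finset.sum_congr rfl fun g _ => by ring

theorem spider_one_one : (spider (phase 0) 1 1 1 1 : WMat Bits 1 1) = 1 := by
  ext y x
  simp only [spider, phase_zero, one_mul, Matrix.one_apply, Finset.univ_unique,
    Finset.prod_singleton, ite_mul, zero_mul, Finset.sum_ite_eq, Finset.mem_univ, if_true,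
    funext_iff, Unique.forall_iff]
  simp only [eq_comm]

/-- Being a permutation of letters, the slide commutes with diagrams by mere reindexing. -/
theorem ev_slide (n : ℕ) : ev (slide n) = rewire (finAddFlip : Fin (1 + n) ≃ Fin (n + 1)) := by
  induction n with
  | zero =>
    rw [slide, ev, ← rewire_id]
    congr 1
    funext i
    exact Subsingleton.elim _ _
  | succ n ih =>
    rw [slide, ev, ev, ih, ev, ev, ev_wires, ev, ← rewire_id, ← rewire_id, kron_rewire,
      kron_rewire, rewire_mul_rewire]
    congr 1
    funext i
    let g : Fin (n + 2) → Fin (n + 2) := Fin.addCases (fun i => Fin.castAdd 2 i)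
      fun i : Fin 2 => Fin.natAdd n (Equiv.swap 0 1 i)
    have g_old : ∀ i : Fin n, g (Fin.castAdd 1 (Fin.castAdd 1 i)) = Fin.castAdd 2 i :=
      fun i => Fin.addCases_left (m := n) (n := 2) i
    have g_one : g (Fin.castAdd 1 (Fin.natAdd n 0)) = Fin.natAdd n (1 : Fin 2) :=
      Fin.addCases_right (m := n) (n := 2) 0
    have g_two : g (Fin.natAdd (n + 1) (0 : Fin 1)) = Fin.natAdd n (0 : Fin 2) :=
      Fin.addCases_right (m := n) (n := 2) 1
    change g _ = _
    refine Fin.addCases (fun i => ?_) (fun i => ?_) i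
    · rw [Fin.addCases_left]
      refine Fin.addCases (fun i => ?_) (fun i => ?_) i
      · rw [Subsingleton.elim i 0, finAddFlip_apply_castAdd, g_one]
        exact (finAddFlip_apply_castAdd (0 : Fin 1) (n + 1)).symm
      · rw [finAddFlip_apply_natAdd, g_old]
        exact (finAddFlip_apply_natAdd (Fin.castAdd 1 i) 1).symm
    · rw [Fin.addCases_right, Subsingleton.elim i 0, g_two]
      exact (finAddFlip_apply_natAdd (Fin.natAdd n (0 : Fin 1)) 1).symm

set_option linter.unusedSimpArgs false in
theorem sound_topology {a b : ℕ} {D E : Diagram a b} (h : Topology D E) : ev D = ev E := by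
  induction h with
  | comp_assoc D₃ D₂ D₁ => exact Matrix.mul_assoc _ _ _
  | wires_comp D => rw [ev, ev_wires, Matrix.one_mul]
  | comp_wires D => rw [ev, ev_wires, Matrix.mul_one]
  | interchange D₂ D₁ E₂ E₁ => exact kron_mul _ _ _ _
  | tensor_empty D =>
    ext y x
    rw [ev, ev, kron, Matrix.one_apply, if_pos (Subsingleton.elim _ _), mul_one]
    rfl
  | empty_tensor D =>
    ext y x
    rw [ev_cast, ev, ev, kron, Matrix.one_apply, if_pos (Subsingleton.elim _ _), one_mul]
    congr 1
    · funext i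
      exact congrArg y (Fin.ext (Nat.zero_add _))
    · funext i
      exact congrArg x (Fin.ext (Nat.zero_add _))
  | tensor_assoc D D' D'' =>
    ext y x
    rw [ev_cast]
    simp only [ev, kron, mul_assoc]
    congr 1
    congr 2 <;> funext i <;> congr 1 <;> ext <;> simp [add_assoc]
  | swap_swap =>
    rw [ev, ev, ev_wires, rewire_mul_rewire, ← rewire_id]
    simp
  | slide_natural D =>
    rename_i a b
    change ev (slide _) * kron (ev D) 1 = kron 1 (ev D) * ev (slide _)
    rw [ev_slide, ev_slide]
    ext y x
    rw [mul_rewire, rewire_equiv_mul]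
    simp only [kron, finAddFlip_apply_natAdd]
    rw [mul_comm]
    have h1 : ∀ i, (finAddFlip.symm (Fin.castAdd 1 i) : Fin (1 + b)) = Fin.natAdd 1 i := fun i => by
      rw [Equiv.symm_apply_eq, finAddFlip_apply_natAdd]
    have h2 : ∀ i, (finAddFlip.symm (Fin.natAdd b i) : Fin (1 + b)) = Fin.castAdd b i := fun i => by
      rw [Equiv.symm_apply_eq, finAddFlip_apply_castAdd]
    have h3 : ∀ i : Fin 1, (finAddFlip (Fin.castAdd a i) : Fin (a + 1)) = Fin.natAdd a i :=
      fun i => finAddFlip_apply_castAdd i a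
    simp only [Matrix.one_apply, h1, h2, h3]
  | swap_eta => exact rewire_mul_spider _ _ _ _
  | yanking => exact (spider_bend (phase 0) 1 0).trans spider_one_one
  | exchange_legs n a b α =>
    -- The transposition of the two middle legs, as an equivalence, so that symmetry of spiders
    -- applies.
    let e : Fin (a + (2 + b)) ≃ Fin (a + (2 + b)) := finSumFinEquiv.symm.trans
      ((Equiv.sumCongr (Equiv.refl _) (finSumFinEquiv.symm.trans
        ((Equiv.sumCongr (Equiv.swap 0 1) (Equiv.refl _)).trans finSumFinEquiv))).trans
          finSumFinEquiv)
    have he : ev (wires a ⊠ swap ⊠ wires b) = rewire e := by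
      simp only [ev, ev_wires, ← rewire_id]
      rw [kron_rewire, kron_rewire]
      congr 1
      funext i
      refine Fin.addCases (fun i => ?_) (fun i => ?_) i
      · simp only [e, Equiv.trans_apply, finSumFinEquiv_symm_apply_castAdd,
          finSumFinEquiv_symm_apply_natAdd, Equiv.sumCongr_apply, Sum.map_inl, Sum.map_inr,
          finSumFinEquiv_apply_left, finSumFinEquiv_apply_right, Fin.addCases_left,
          Fin.addCases_right, Equiv.refl_apply]
      · refine Fin.addCases (fun i => ?_) (fun i => ?_) i <;> simp only [e, Equiv.trans_apply, finSumFinEquiv_symm_apply_castAdd,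
          finSumFinEquiv_symm_apply_natAdd, Equiv.sumCongr_apply, Sum.map_inl, Sum.map_inr,
          finSumFinEquiv_apply_left, finSumFinEquiv_apply_right, Fin.addCases_left,
          Fin.addCases_right, Equiv.refl_apply]
    rw [ev_comp, he]
    exact rewire_mul_spider e _ _ _
  | bend_leg n m α =>
    simp only [ev, ev_wires]
    exact spider_bend (phase α) n m
  | bend_H =>
    ext (y : Fin 2 → Bits) (x : Fin 0 → Bits)
    simp only [ev]
    rw [Matrix.mul_apply, Matrix.mul_apply]
    simp only [eta_apply, sum_words_succ]
    simp [kron, power, Matrix.one_apply, funext_iff]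
    exact congrFun (congrFun had_transpose (y 1)) (y 0)

/-! ### Red dots as Fourier transforms -/

theorem chi_sum (g : Bits) {n : ℕ} (x : Fin n → Bits) : chi g (∑ i, x i) = ∏ i, chi g (x i) := by
  induction n with
  | zero => simp [chi_zero]
  | succ n ih => rw [Fin.sum_univ_succ, Fin.prod_univ_succ, chi_add, ih]

theorem prod_had (g : Bits) {n : ℕ} (x : Fin n → Bits) :
    ∏ i, had (x i) g = chi g (∑ i, x i) / rt ^ n := by
  rw [chi_sum]
  simp only [had, Finset.prod_div_distrib, Finset.prod_const, Finset.card_univ, Fintype.card_fin,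
    chi_comm g]
  push_cast
  rfl

/-- The Fourier transform of a function on triples of bits. -/
noncomputable def fourier (f : Bits → ℂ) (s : Bits) : ℂ := ∑ g, f g * chi g s

/-- Characters are multiplicative, so a red dot sees its legs only through their sum. -/
theorem spider_had_apply (f : Bits → ℂ) (n m : ℕ) (y : Fin m → Bits) (x : Fin n → Bits) :
    spider f had had n m y x = fourier f (∑ i, y i + ∑ i, x i) / rt ^ (m + n) := by
  rw [spider, fourier, Finset.sum_div]
  refine Finset.sum_congr rfl fun g _ => ?_
  rw [prod_had, prod_had, chi_add, pow_add]
  push_cast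
  field_simp

theorem fourier_phase_zero (s : Bits) : fourier (phase 0) s = if s = 0 then 8 else 0 := by
  simp only [fourier, phase_zero, one_mul]
  rw [← Int.cast_sum, sum_chi]
  split_ifs <;> simp

theorem toCircle_pi : (((Real.pi : ℝ) : Real.Angle).toCircle : ℂ) = -1 := by
  simp

theorem toCircle_pi_div_two : (((Real.pi / 2 : ℝ) : Real.Angle).toCircle : ℂ) = Complex.I := by
  rw [Real.Angle.toCircle_coe, Circle.coe_exp]
  push_cast
  exact Complex.exp_pi_div_two_mul_I

theorem chi_one (g : Bits) : chi g 1 = if Even (wt g) then 1 else -1 := by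
  revert g; decide

/-- `wt` has the parity of the number of ones, so the phase `π` is a character. Its Fourier
transform is concentrated at `1`, which makes the red `π` dot a translation. -/
theorem phase_pi (g : Bits) : phase (Real.pi : ℝ) g = chi g 1 := by
  rw [phase, toCircle_pi, chi_one]
  split_ifs with h
  · simp [h.neg_one_zpow]
  · simp [(Int.not_even_iff_odd.1 h).neg_one_zpow]

theorem phase_neg (α : Real.Angle) (g : Bits) : phase (-α) g = (phase α g)⁻¹ := by
  simp [phase]

theorem fourier_phase_pi (s : Bits) :
    fourier (phase (Real.pi : ℝ)) s = if s = 1 then 8 else 0 := by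
  have h : ∀ s : Bits, 1 + s = 0 ↔ s = 1 := by decide
  simp only [fourier, phase_pi, ← Int.cast_mul, ← chi_add]
  rw [← Int.cast_sum, sum_chi]
  simp only [h]
  split_ifs <;> simp

theorem sum_words_one (F : (Fin 1 → Bits) → ℂ) : ∑ z, F z = ∑ g, F fun _ => g := by
  rw [sum_words_succ]
  refine Finset.sum_congr rfl fun g _ => ?_
  rw [Fintype.sum_unique]
  congr 1
  funext i
  rw [(Fin.fin_one_eq_zero i : i = (0 : Fin 1))]
  rfl

theorem sum_words_two (F : (Fin 2 → Bits) → ℂ) : ∑ z, F z = ∑ g, ∑ h, F ![g, h] := by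
  rw [sum_words_succ]
  refine Finset.sum_congr rfl fun g _ => ?_
  rw [sum_words_one]
  refine Finset.sum_congr rfl fun h _ => congrArg F ?_
  funext i
  fin_cases i <;> rfl

/-- The value of a diagram without inputs and outputs. -/
noncomputable def scalarValue (s : Diagram 0 0) : ℂ := ev s default default

theorem ev_scalar_tensor (s : Diagram 0 0) {a b : ℕ} (D : Diagram a b) :
    ev ((s ⊠ D).cast (Nat.zero_add a) (Nat.zero_add b)) = scalarValue s • ev D := by
  ext y x
  rw [ev_cast, ev_tensor, kron, Matrix.smul_apply, smul_eq_mul, scalarValue]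
  congr 1
  · congr 1 <;> exact Subsingleton.elim _ _
  · congr 1
    · funext i
      exact congrArg y (Fin.ext (Nat.zero_add _))
    · funext i
      exact congrArg x (Fin.ext (Nat.zero_add _))

/-- Three copies of `√2`. -/
theorem scalarValue_line : scalarValue line = rt := by
  rw [scalarValue, line, ev_comp, Matrix.mul_apply, sum_words_one]
  simp only [ev, spider_had_apply, spider_one_apply, fourier_phase_zero, phase_zero, funext_iff]
  have := rt_ne_zero
  simp [ite_div]
  rw [← rt_mul_rt]
  field_simp

theorem scalarValue_tripleLine : scalarValue tripleLine = rt⁻¹ := by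
  have h : ∀ g : Bits, g + g + g = 0 ↔ g = 0 := by decide
  rw [scalarValue, tripleLine, ev_comp, Matrix.mul_apply]
  have h1 : ∀ z : Fin 3 → Bits, ∀ x, ev (Z 0 3 0) z x = ∑ g, if z = (fun _ => g) then 1 else 0 := by
    intro z x
    simp only [ev, spider_one_apply, phase_zero, one_mul]
    exact Finset.sum_congr rfl fun g _ => by rw [if_pos (Subsingleton.elim x _), mul_one]
  simp only [h1, Finset.mul_sum]
  rw [Finset.sum_comm]
  simp only [mul_ite, mul_one, mul_zero, Finset.sum_ite_eq', Finset.mem_univ, if_true]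
  simp only [ev, spider_had_apply, fourier_phase_zero, Fin.sum_univ_three]
  have := rt_ne_zero
  simp [h, ite_div]
  rw [← rt_mul_rt]
  field_simp

theorem copy_eq_rewire : ev (Z 1 2 0) = rewire fun _ => 0 := by
  ext (y : Fin 2 → Bits) (x : Fin 1 → Bits)
  simp only [ev, spider_one_apply, rewire, phase_zero, one_mul]
  have h : ∀ g, (x = fun _ => g) ↔ x 0 = g := fun g => by
    simp only [funext_iff, Unique.forall_iff]
    rfl
  simp only [h, mul_ite, mul_one, mul_zero, Finset.sum_ite_eq, Finset.mem_univ, if_true]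

theorem red_not_apply (y x : Fin 1 → Bits) :
    ev (X 1 1 (Real.pi : ℝ)) y x = if y 0 = x 0 + 1 then 1 else 0 := by
  have h : ∀ a b : Bits, a + b = 1 ↔ a = b + 1 := by decide
  simp only [ev, spider_had_apply, fourier_phase_pi, Finset.univ_unique, Finset.sum_singleton, h]
  rw [pow_two, rt_mul_rt]
  simp only [Fin.default_eq_zero]
  split_ifs <;> simp

theorem red_state_apply (y : Fin 1 → Bits) (x : Fin 0 → Bits) :
    ev (X 0 1 0) y x = if y 0 = 0 then rt else 0 := by
  simp only [ev, spider_had_apply, fourier_phase_zero, Finset.univ_unique, Finset.sum_singleton,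
    Finset.univ_eq_empty, Finset.sum_empty, add_zero, Fin.default_eq_zero]
  have := rt_ne_zero
  rw [← rt_mul_rt, ite_div, zero_div]
  simp [this]

theorem red_merge_apply (y : Fin 1 → Bits) (x : Fin 2 → Bits) :
    ev (X 2 1 0) y x = if y 0 = x 0 + x 1 then rt⁻¹ else 0 := by
  have h : ∀ a b : Bits, a + b = 0 ↔ a = b := by decide
  simp only [ev, spider_had_apply, fourier_phase_zero, Finset.univ_unique, Finset.sum_singleton,
    Fin.default_eq_zero, Fin.sum_univ_two, h]
  have := rt_ne_zero
  rw [← rt_mul_rt, ite_div, zero_div]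
  congr 1
  field_simp

theorem phase_one_mul (α : Real.Angle) (x : Bits) :
    phase α 1 * (phase α (x + 1))⁻¹ = phase α x := by
  simp only [phase]
  rw [← wt_compl x, zpow_sub₀ (Circle.coe_ne_zero _)]
  rfl

theorem green_apply (α : Real.Angle) (y x : Fin 1 → Bits) :
    ev (Z 1 1 α) y x = if y 0 = x 0 then phase α (x 0) else 0 := by
  have h : ∀ z : Fin 1 → Bits, ∀ g, (z = fun _ => g) ↔ z 0 = g := fun z g => by
    simp only [funext_iff, Unique.forall_iff]
    rfl
  simp only [ev, spider_one_apply, h, mul_ite, mul_one, mul_zero, Finset.sum_ite_eq,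
    Finset.mem_univ, if_true]

/-- The powers of the imaginary unit with exponents `wt g`. -/
def gaussPhase (g : Bits) : GaussianInt :=
  if wt g = 0 then 1 else if wt g = 1 then ⟨0, 1⟩ else if wt g = -2 then -1 else ⟨0, -1⟩

/-- The third tensor power of the one-bit Euler identity, whose constant is `2`. All phases are
Gaussian integers, so it is a finite exact computation. -/
theorem gauss_euler (y x : Bits) : (∑ g, star (gaussPhase g)) *
    (gaussPhase y * ((∑ g, gaussPhase g * (chi g (y + x) : ℤ)) * gaussPhase x)) =
      8 * (chi y x : ℤ) := by
  revert y x; decide +kernel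

theorem wt_cases (g : Bits) : wt g = 0 ∨ wt g = 1 ∨ wt g = -2 ∨ wt g = -1 := by
  revert g; decide

theorem phase_pi_div_two (g : Bits) : phase (Real.pi / 2 : ℝ) g = (gaussPhase g).toComplex := by
  rw [phase, toCircle_pi_div_two, gaussPhase]
  rcases wt_cases g with h | h | h | h <;> simp [h, GaussianInt.toComplex_def, zpow_neg]

theorem phase_neg_pi_div_two (g : Bits) :
    phase (-(Real.pi / 2) : ℝ) g = (star (gaussPhase g)).toComplex := by
  rw [Real.Angle.coe_neg, phase_neg, phase_pi_div_two, gaussPhase]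
  rcases wt_cases g with h | h | h | h <;> simp [h, GaussianInt.toComplex_def]

theorem euler_phase (y x : Bits) : (∑ g, phase (-(Real.pi / 2) : ℝ) g) *
    (phase (Real.pi / 2 : ℝ) y * (fourier (phase (Real.pi / 2 : ℝ)) (y + x) *
      phase (Real.pi / 2 : ℝ) x)) = 8 * (chi y x : ℤ) := by
  simp only [fourier, phase_pi_div_two, phase_neg_pi_div_two]
  have := congrArg GaussianInt.toComplex (gauss_euler y x)
  simpa only [map_mul, map_sum, map_intCast, map_ofNat] using this

/-! ### Soundness of the calculus -/

theorem sound_rule {a b : ℕ} {D E : Diagram a b} (h : Rule D E) : ev D = ev E := by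
  induction h with
  | topology h => exact sound_topology h
  | S1 a b c d k α β =>
    rw [ev_comp, ev_tensor, ev_wires, ev]
    refine (spider_fusion (phase α) (phase β) a b c d k _ fun u v w x => ?_).trans ?_
    · rw [ev_cast, ev_tensor, ev_wires, Fin.append_assoc]
      rfl
    · rw [ev]
      congr 1
      funext g
      rw [phase_add]
  | S2 => exact spider_one_one
  | S3 => rfl
  | B1 =>
    refine (ev_scalar_tensor line (Z 1 2 0 ⊚ X 0 1 0)).trans ?_
    ext (y : Fin 2 → Bits) (x : Fin 0 → Bits)
    rw [scalarValue_line, Matrix.smul_apply, ev_comp, copy_eq_rewire, Matrix.mul_apply,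
      sum_words_one, ev_tensor, kron, red_state_apply, red_state_apply]
    simp only [red_state_apply, rewire, funext_iff, Fin.forall_fin_two]
    change rt * ∑ g, (if y 0 = g ∧ y 1 = g then (1 : ℂ) else 0) * (if g = 0 then rt else 0) =
      (if y 0 = 0 then rt else 0) * if y 1 = 0 then rt else 0
    simp only [mul_ite, mul_zero, Finset.sum_ite_eq', Finset.mem_univ, if_true]
    split_ifs <;> simp_all
  | B2 =>
    refine (ev_scalar_tensor line
      ((X 2 1 0 ⊠ X 2 1 0) ⊚ (wire ⊠ swap ⊠ wire) ⊚ (Z 1 2 0 ⊠ Z 1 2 0))).trans ?_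
    -- Copying both letters and crossing the middle wires sends `ab` to `abab`.
    have he : ev ((wire ⊠ swap ⊠ wire) ⊚ (Z 1 2 0 ⊠ Z 1 2 0)) =
        (rewire ![0, 1, 0, 1] : WMat Bits 4 2) := by
      rw [ev_comp, ev_tensor, ev_tensor, ev_tensor, copy_eq_rewire, ev, ev, ← rewire_id,
        kron_rewire, kron_rewire, kron_rewire]
      refine (rewire_mul_rewire _ _).trans (congrArg rewire ?_)
      decide
    ext (y : Fin 2 → Bits) (x : Fin 2 → Bits)
    rw [scalarValue_line, Matrix.smul_apply, ev_comp, he, mul_rewire, ev_tensor, kron,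
      red_merge_apply, red_merge_apply, ev_comp, copy_eq_rewire, Matrix.mul_apply, sum_words_one]
    simp only [red_merge_apply, rewire, funext_iff, Fin.forall_fin_two]
    change rt * ((if y 0 = x 0 + x 1 then rt⁻¹ else 0) * if y 1 = x 0 + x 1 then rt⁻¹ else 0) =
      ∑ g, (if y 0 = g ∧ y 1 = g then (1 : ℂ) else 0) * (if g = x 0 + x 1 then rt⁻¹ else 0)
    have := rt_ne_zero
    simp only [mul_ite, mul_zero, Finset.sum_ite_eq', Finset.mem_univ, if_true]
    split_ifs <;> simp_all
  | K1 =>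
    ext (y : Fin 2 → Bits) (x : Fin 1 → Bits)
    rw [ev_comp, ev_comp, copy_eq_rewire, mul_rewire, Matrix.mul_apply, sum_words_one, ev_tensor,
      kron, red_not_apply, red_not_apply]
    simp only [red_not_apply, rewire, funext_iff, Fin.forall_fin_two]
    change ∑ g, (if y 0 = g ∧ y 1 = g then (1 : ℂ) else 0) * (if g = x 0 + 1 then 1 else 0) =
      (if y 0 = x 0 + 1 then 1 else 0) * if y 1 = x 0 + 1 then 1 else 0
    simp only [mul_ite, mul_zero, mul_one, Finset.sum_ite_eq', Finset.mem_univ, if_true]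
    split_ifs <;> simp_all
  | K2 α =>
    refine (ev_scalar_tensor line (X 1 1 (Real.pi : ℝ) ⊚ Z 1 1 α)).trans
      (Eq.trans ?_ (ev_scalar_tensor _ (Z 1 1 (-α) ⊚ X 1 1 (Real.pi : ℝ))).symm)
    have hs : scalarValue (X 1 0 (Real.pi : ℝ) ⊚ Z 0 1 α) = rt * phase α 1 := by
      have := rt_ne_zero
      rw [scalarValue, ev_comp, Matrix.mul_apply, sum_words_one]
      simp only [ev, spider_had_apply, spider_one_apply, fourier_phase_pi, funext_iff]
      simp [ite_div]
      rw [← rt_mul_rt]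
      field_simp
      exact Or.inl trivial
    ext (y : Fin 1 → Bits) (x : Fin 1 → Bits)
    rw [scalarValue_line, hs, Matrix.smul_apply, Matrix.smul_apply, ev_comp, ev_comp,
      Matrix.mul_apply, Matrix.mul_apply, sum_words_one, sum_words_one]
    simp only [red_not_apply, green_apply, phase_neg]
    simp only [mul_ite, mul_zero, mul_one, Finset.sum_ite_eq', Finset.mem_univ,
      if_true, ite_mul, zero_mul, one_mul, smul_eq_mul]
    split_ifs with h
    · rw [mul_assoc, phase_one_mul]
    · rfl
  | EU =>
    refine (ev_scalar_tensor line Diagram.H).trans (Eq.trans ?_ (ev_scalar_tensor _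
      (Z 1 1 (Real.pi / 2 : ℝ) ⊚ X 1 1 (Real.pi / 2 : ℝ) ⊚ Z 1 1 (Real.pi / 2 : ℝ))).symm)
    have hs : scalarValue (Z 0 0 (-(Real.pi / 2) : ℝ)) = ∑ g, phase (-(Real.pi / 2) : ℝ) g := by
      simp only [scalarValue, ev, spider, Finset.univ_eq_empty, Finset.prod_empty, mul_one]
    ext (y : Fin 1 → Bits) (x : Fin 1 → Bits)
    rw [scalarValue_line, hs, Matrix.smul_apply, Matrix.smul_apply, ev_comp, ev_comp,
      Matrix.mul_apply, sum_words_one]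
    simp only [Matrix.mul_apply, sum_words_one, green_apply]
    simp only [mul_ite, mul_zero, Finset.sum_ite_eq', Finset.sum_ite_eq, Finset.mem_univ,
      if_true, ite_mul, zero_mul, smul_eq_mul]
    have := rt_ne_zero
    have key := euler_phase (y 0) (x 0)
    simp only [ev, spider_had_apply, power, had, Finset.univ_unique, Finset.prod_singleton,
      Finset.sum_singleton, Fin.default_eq_zero]
    rw [pow_two, rt_mul_rt]
    rw [mul_div_cancel₀ _ this]
    linear_combination (-1 / 8) * key
  | H n m α =>
    rw [ev_comp, ev_comp, ev_hadamards, ev_hadamards, ← Matrix.mul_assoc]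
    exact had_spider_had _ _ _
  | IV =>
    refine (ev_scalar_tensor tripleLine line).trans ?_
    ext y x
    rw [Matrix.smul_apply, scalarValue_tripleLine, Subsingleton.elim y default,
      Subsingleton.elim x default]
    change rt⁻¹ * scalarValue line = _
    rw [scalarValue_line, inv_mul_cancel₀ rt_ne_zero]
    rfl
  | ZO =>
    refine (ev_scalar_tensor (Z 0 0 (Real.pi : ℝ)) wire).trans
      (Eq.trans ?_ (ev_scalar_tensor (Z 0 0 (Real.pi : ℝ)) (X 0 1 0 ⊚ Z 1 0 0)).symm)
    -- The sum of a nontrivial character vanishes, so both sides of (ZO) are zero.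
    have h : scalarValue (Z 0 0 (Real.pi : ℝ)) = 0 := by
      have := fourier_phase_pi 0
      simp only [fourier, chi_zero] at this
      simp only [scalarValue, ev, spider, Finset.univ_eq_empty, Finset.prod_empty, mul_one]
      simpa using this
    rw [h, zero_smul, zero_smul]

theorem sound {a b : ℕ} {D E : Diagram a b} (h : Derivable D E) : ev D = ev E := by
  induction h with
  | rule h => exact sound_rule h
  | rule_swapped h => rw [ev_colourSwap, ev_colourSwap, sound_rule h]
  | rule_flipped h => rw [ev_flip, ev_flip, sound_rule h]
  | rule_swapped_flipped h =>
    rw [ev_flip, ev_flip, ev_colourSwap, ev_colourSwap, sound_rule h]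
  | refl => rfl
  | symm _ ih => exact ih.symm
  | trans _ _ ih₁ ih₂ => exact ih₁.trans ih₂
  | tensor _ _ ih₁ ih₂ => rw [ev_tensor, ev_tensor, ih₁, ih₂]
  | comp _ _ ih₁ ih₂ => rw [ev_comp, ev_comp, ih₁, ih₂]

/-! ### Supplementarity in the model -/

theorem green_state_apply (α : Real.Angle) (y : Fin 1 → Bits) (x : Fin 0 → Bits) :
    ev (Z 0 1 α) y x = phase α (y 0) := by
  have h : ∀ z : Fin 1 → Bits, ∀ g, (z = fun _ => g) ↔ z 0 = g := fun z g => by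
    simp only [funext_iff, Unique.forall_iff]
    rfl
  simp only [ev, spider_one_apply, h]
  simp [funext_iff]

theorem green_pair_apply (α : Real.Angle) (y : Fin 2 → Bits) (x : Fin 0 → Bits) :
    ev (Z 0 2 α) y x = if y 0 = y 1 then phase α (y 0) else 0 := by
  simp only [ev, spider_one_apply, funext_iff, Fin.forall_fin_two, ite_and]
  simp [eq_comm]

theorem ev_suppLeft (α : Real.Angle) (s : Bits) (x : Fin 0 → Bits) :
    ev (suppLeft α) (fun _ => s) x = rt⁻¹ * ∑ g, phase α g * phase (α + (Real.pi : ℝ)) (g + s) := by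
  have h : ∀ a b c : Bits, a = b + c ↔ c = b + a := by decide
  rw [suppLeft, ev_comp, Matrix.mul_apply, sum_words_two, Finset.mul_sum]
  refine Finset.sum_congr rfl fun g _ => ?_
  rw [Finset.sum_eq_single (g + s)]
  · rw [red_merge_apply, if_pos (c := s = ![g, g + s] 0 + ![g, g + s] 1) ((h s g (g + s)).2 rfl),
      ev_tensor, kron, green_state_apply,
      green_state_apply]
    rfl
  · intro t _ ht
    rw [red_merge_apply, if_neg (c := s = ![g, t] 0 + ![g, t] 1)
      (fun h' => ht ((h s g t).1 h')), zero_mul]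
  · simp

/-- Both legs carry the same letter, and `g + g = 0`. -/
theorem ev_suppRight (α : Real.Angle) (s : Bits) (hs : s ≠ 0) (x : Fin 0 → Bits) :
    ev (suppRight α) (fun _ => s) x = 0 := by
  have h : ∀ a : Bits, a + a = 0 := by decide
  rw [suppRight, ev_comp, Matrix.mul_apply, sum_words_two]
  refine Finset.sum_eq_zero fun g _ => Finset.sum_eq_zero fun t _ => ?_
  rw [red_merge_apply, green_pair_apply]
  by_cases hg : g = t
  · subst hg
    rw [if_neg, zero_mul]
    simpa [h] using hs
  · rw [if_neg (c := ![g, t] 0 = ![g, t] 1) hg, mul_zero]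

theorem sum_bits (F : Bits → ℂ) : ∑ g, F g = F (0, 0, 0) + F (0, 0, 1) + F (0, 1, 0) + F (0, 1, 1) +
    F (1, 0, 0) + F (1, 0, 1) + F (1, 1, 0) + F (1, 1, 1) := by
  have h : ∀ F : ZMod 2 → ℂ, ∑ g, F g = F 0 + F 1 := fun F => Fin.sum_univ_two F
  simp only [Fintype.sum_prod_type, h]
  ring

theorem pow_four_of_derivable (α : Real.Angle) (h : Derivable (suppLeft α) (suppRight α)) :
    (α.toCircle : ℂ) ^ 4 = 1 := by
  -- Pairing `g` with `g + (1, 1, 0)` gives `2(b⁻⁴ + b⁻² - 1 - b²)`. With the plain number of ones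
  -- as weight, the terms would cancel.
  have h0 := congrFun (congrFun (sound h) fun _ => (1, 1, 0)) default
  rw [ev_suppLeft, ev_suppRight _ _ (by decide)] at h0
  have h1 := (mul_eq_zero.1 h0).resolve_left (inv_ne_zero rt_ne_zero)
  simp only [phase_add, phase_pi, sum_bits] at h1
  have hb : (α.toCircle : ℂ) ≠ 0 := Circle.coe_ne_zero _
  simp only [phase] at h1
  set b : ℂ := (α.toCircle : ℂ)
  have w0 : wt (0, 0, 0) = 0 := rfl
  have w1 : wt (0, 0, 1) = 1 := rfl
  have w2 : wt (0, 1, 0) = 1 := rfl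
  have w3 : wt (0, 1, 1) = -2 := rfl
  have w4 : wt (1, 0, 0) = 1 := rfl
  have w5 : wt (1, 0, 1) = -2 := rfl
  have w6 : wt (1, 1, 0) = -2 := rfl
  have w7 : wt (1, 1, 1) = -1 := rfl
  have a0 : ((0, 0, 0) : Bits) + (1, 1, 0) = (1, 1, 0) := rfl
  have a1 : ((0, 0, 1) : Bits) + (1, 1, 0) = (1, 1, 1) := rfl
  have a2 : ((0, 1, 0) : Bits) + (1, 1, 0) = (1, 0, 0) := rfl
  have a3 : ((0, 1, 1) : Bits) + (1, 1, 0) = (1, 0, 1) := rfl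
  have a4 : ((1, 0, 0) : Bits) + (1, 1, 0) = (0, 1, 0) := rfl
  have a5 : ((1, 0, 1) : Bits) + (1, 1, 0) = (0, 1, 1) := rfl
  have a6 : ((1, 1, 0) : Bits) + (1, 1, 0) = (0, 0, 0) := rfl
  have a7 : ((1, 1, 1) : Bits) + (1, 1, 0) = (0, 0, 1) := rfl
  have c0 : chi (0, 0, 0) 1 = 1 := rfl
  have c1 : chi (0, 0, 1) 1 = -1 := rfl
  have c2 : chi (0, 1, 0) 1 = -1 := rfl
  have c3 : chi (0, 1, 1) 1 = 1 := rfl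
  have c4 : chi (1, 0, 0) 1 = -1 := rfl
  have c5 : chi (1, 0, 1) 1 = 1 := rfl
  have c6 : chi (1, 1, 0) 1 = 1 := rfl
  have c7 : chi (1, 1, 1) 1 = -1 := rfl
  simp only [w0, w1, w2, w3, w4, w5, w6, w7, a0, a1, a2, a3, a4, a5, a6, a7, c0, c1, c2, c3, c4,
    c5, c6, c7, zpow_neg, zpow_ofNat] at h1
  push_cast at h1
  field_simp at h1
  have h2 : (1 + b ^ 2) * (1 - b ^ 4) = 0 := by
    linear_combination h1 / 2
  -- Either factor divides `b⁴ - 1`.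
  rcases mul_eq_zero.1 h2 with h3 | h3
  · linear_combination (b ^ 2 - 1) * h3
  · linear_combination -h3

theorem multiple_of_derivable (α : ℝ) (h : Derivable (suppLeft (α : Real.Angle)) (suppRight α)) :
    ∃ k : ℤ, α = k * (Real.pi / 2) := by
  have h4 := pow_four_of_derivable _ h
  rw [Real.Angle.toCircle_coe, Circle.coe_exp, ← Complex.exp_nat_mul, Complex.exp_eq_one_iff] at h4
  obtain ⟨k, hk⟩ := h4
  refine ⟨k, ?_⟩
  have h5 : (4 * α : ℂ) = k * (2 * Real.pi) := by
    apply mul_right_cancel₀ Complex.I_ne_zero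
    push_cast at hk
    linear_combination hk
  have h6 : 4 * α = k * (2 * Real.pi) := by exact_mod_cast h5
  linarith

/-! ### Diagrams up to derivable equality -/

/-- Derivable equality as a setoid. -/
def derivableSetoid (a b : ℕ) : Setoid (Diagram a b) :=
  ⟨Derivable, Derivable.refl, Derivable.symm, Derivable.trans⟩

/-- Diagrams up to derivable equality. -/
def Mor (a b : ℕ) : Type := Quotient (derivableSetoid a b)

namespace Mor

/-- The class of a diagram. -/
def mk {a b : ℕ} (D : Diagram a b) : Mor a b := Quotient.mk _ D

/-- Composition of classes. -/
def comp {a b c : ℕ} : Mor b c → Mor a b → Mor a c :=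
  Quotient.map₂ Diagram.comp fun _ _ h _ _ h' => Derivable.comp h h'

/-- Juxtaposition of classes. -/
def tensor {a b c d : ℕ} : Mor a b → Mor c d → Mor (a + c) (b + d) :=
  Quotient.map₂ Diagram.tensor fun _ _ h _ _ h' => Derivable.tensor h h'

/-- Transport of a class along equalities of the numbers of inputs and outputs. -/
def cast {a b a' b' : ℕ} (ha : a = a') (hb : b = b') (f : Mor a b) : Mor a' b' :=
  ha ▸ hb ▸ f

end Mor

scoped infixr:80 " ⊙ " => Mor.comp
scoped infixr:85 " ⊡ " => Mor.tensor

namespace Mor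

theorem mk_eq {a b : ℕ} {D E : Diagram a b} (h : Derivable D E) : mk D = mk E :=
  Quotient.sound h

theorem mk_eq_iff {a b : ℕ} {D E : Diagram a b} : mk D = mk E ↔ Derivable D E :=
  ⟨fun h => Quotient.exact h, mk_eq⟩

theorem mk_cast {a b a' b' : ℕ} (ha : a = a') (hb : b = b') (D : Diagram a b) :
    mk (D.cast ha hb) = (mk D).cast ha hb := by
  subst ha hb
  rfl

theorem of_topology {a b : ℕ} {D E : Diagram a b} (h : Topology D E) : mk D = mk E :=
  mk_eq (.rule (.topology h))

/-- The class of `n` parallel wires. -/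
def id (n : ℕ) : Mor n n := mk (wires n)

theorem comp_assoc {a b c d : ℕ} (f : Mor c d) (g : Mor b c) (h : Mor a b) :
    (f ⊙ g) ⊙ h = f ⊙ g ⊙ h := by
  induction f using Quotient.inductionOn
  induction g using Quotient.inductionOn
  induction h using Quotient.inductionOn
  exact of_topology (.comp_assoc _ _ _)

theorem id_comp {a b : ℕ} (f : Mor a b) : id b ⊙ f = f := by
  induction f using Quotient.inductionOn
  exact of_topology (.wires_comp _)

theorem comp_id {a b : ℕ} (f : Mor a b) : f ⊙ id a = f := by
  induction f using Quotient.inductionOn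
  exact of_topology (.comp_wires _)

theorem interchange {a b c a' b' c' : ℕ} (f₂ : Mor b c) (f₁ : Mor a b) (g₂ : Mor b' c')
    (g₁ : Mor a' b') : (f₂ ⊡ g₂) ⊙ (f₁ ⊡ g₁) = (f₂ ⊙ f₁) ⊡ (g₂ ⊙ g₁) := by
  induction f₁ using Quotient.inductionOn
  induction f₂ using Quotient.inductionOn
  induction g₁ using Quotient.inductionOn
  induction g₂ using Quotient.inductionOn
  exact (of_topology (.interchange _ _ _ _)).symm

theorem tensor_id_zero {a b : ℕ} (f : Mor a b) : f ⊡ id 0 = f := by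
  induction f using Quotient.inductionOn
  exact of_topology (.tensor_empty _)

theorem cast_id_zero_tensor {a b : ℕ} (f : Mor a b) :
    (id 0 ⊡ f).cast (Nat.zero_add a) (Nat.zero_add b) = f := by
  induction f using Quotient.inductionOn
  exact (mk_cast _ _ _).symm.trans (of_topology (.empty_tensor _))

theorem cast_tensor_assoc {a b a' b' a'' b'' : ℕ} (f : Mor a b) (g : Mor a' b') (h : Mor a'' b'') :
    ((f ⊡ g) ⊡ h).cast (Nat.add_assoc a a' a'') (Nat.add_assoc b b' b'') = f ⊡ g ⊡ h := by
  induction f using Quotient.inductionOn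
  induction g using Quotient.inductionOn
  induction h using Quotient.inductionOn
  exact (mk_cast _ _ _).symm.trans (of_topology (.tensor_assoc _ _ _))

theorem cast_cast {a b a' b' a'' b'' : ℕ} (ha : a = a') (hb : b = b') (ha' : a' = a'')
    (hb' : b' = b'') (f : Mor a b) :
    (f.cast ha hb).cast ha' hb' = f.cast (ha.trans ha') (hb.trans hb') := by
  subst ha hb ha' hb'
  rfl

theorem cast_comp_cast {a b c a' b' c' : ℕ} (ha : a = a') (hb : b = b') (hc : c = c')
    (f : Mor b c) (g : Mor a b) : f.cast hb hc ⊙ g.cast ha hb = (f ⊙ g).cast ha hc := by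
  subst ha hb hc
  rfl

theorem cast_tensor {a b a' b' c d : ℕ} (ha : a = a') (hb : b = b') (f : Mor a b) (g : Mor c d) :
    f.cast ha hb ⊡ g = (f ⊡ g).cast (ha ▸ rfl) (hb ▸ rfl) := by
  subst ha hb
  rfl

theorem tensor_cast {a b a' b' c d : ℕ} (ha : a = a') (hb : b = b') (f : Mor a b) (g : Mor c d) :
    g ⊡ f.cast ha hb = (g ⊡ f).cast (ha ▸ rfl) (hb ▸ rfl) := by
  subst ha hb
  rfl

theorem id_add_one (n : ℕ) : id (n + 1) = id n ⊡ mk wire := rfl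

theorem wire_eq_id : mk wire = id 1 :=
  (cast_id_zero_tensor (mk wire)).symm

/-- Naturality of the slide for a diagram without legs, where the slide itself is a bare wire. -/
theorem wire_tensor_scalar (s : Mor 0 0) : (id 1 ⊡ s : Mor 1 1) = s ⊡ id 1 := by
  induction s using Quotient.inductionOn with
  | _ s =>
    have h := of_topology (.slide_natural s)
    change mk wire ⊙ (mk s ⊡ mk wire : Mor 1 1) = (mk wire ⊡ mk s) ⊙ mk wire at h
    rw [wire_eq_id, id_comp, comp_id] at h
    exact h.symm

theorem id_tensor_scalar (s : Mor 0 0) (n : ℕ) :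
    (s ⊡ id n).cast (Nat.zero_add n) (Nat.zero_add n) = id n ⊡ s := by
  induction n with
  | zero =>
    have h1 := tensor_id_zero s
    have h2 := cast_id_zero_tensor s
    exact h1.trans h2.symm
  | succ n ih =>
    have h1 : id n ⊡ (id 1 ⊡ s) = ((id n ⊡ id 1) ⊡ s) := (cast_tensor_assoc (id n) (id 1) s).symm
    have h2 : (s ⊡ id n).cast (Nat.zero_add n) (Nat.zero_add n) ⊡ id 1 = (id n ⊡ s) ⊡ id 1 := by
      rw [ih]
    have h3 := cast_tensor_assoc (id n) s (id 1)
    rw [id_add_one, wire_eq_id, ← h1, wire_tensor_scalar, ← h3, ← h2, cast_tensor,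
      ← cast_tensor_assoc, cast_cast, cast_cast]

/-- The multiplication of a diagram by a scalar. -/
def scale {a b : ℕ} (s : Mor 0 0) (f : Mor a b) : Mor a b :=
  (s ⊡ f).cast (Nat.zero_add a) (Nat.zero_add b)

end Mor

scoped infixr:82 " ◃ " => Mor.scale

namespace Mor

/-! ### Calculus of scalars -/

theorem scale_def {a b : ℕ} (s : Mor 0 0) (f : Mor a b) :
    s ◃ f = (s ⊡ f).cast (Nat.zero_add a) (Nat.zero_add b) := rfl

theorem scale_comp {a b c : ℕ} (s : Mor 0 0) (f : Mor b c) (g : Mor a b) :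
    (s ◃ f) ⊙ g = s ◃ (f ⊙ g) := by
  have h : (s ⊡ f) ⊙ (id 0 ⊡ g) = s ⊡ (f ⊙ g) := by
    rw [interchange]
    exact congrArg (· ⊡ (f ⊙ g)) (comp_id s)
  rw [scale_def, scale_def, ← h, ← cast_comp_cast _ (Nat.zero_add b) _, cast_id_zero_tensor]

theorem comp_scale {a b c : ℕ} (s : Mor 0 0) (f : Mor b c) (g : Mor a b) :
    f ⊙ (s ◃ g) = s ◃ (f ⊙ g) := by
  have h : (id 0 ⊡ f) ⊙ (s ⊡ g) = s ⊡ (f ⊙ g) := by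
    rw [interchange]
    exact congrArg (· ⊡ (f ⊙ g)) (id_comp s)
  rw [scale_def, scale_def, ← h, ← cast_comp_cast _ (Nat.zero_add b) _, cast_id_zero_tensor]

theorem scale_tensor {a b c d : ℕ} (s : Mor 0 0) (f : Mor a b) (g : Mor c d) :
    (s ◃ f) ⊡ g = s ◃ (f ⊡ g) := by
  rw [scale_def, scale_def, cast_tensor, ← cast_tensor_assoc, cast_cast]

theorem tensor_scalar {a b : ℕ} (s : Mor 0 0) (f : Mor a b) : f ⊡ s = s ◃ f := by
  have h : f ⊡ s = (f ⊡ id 0) ⊙ (id a ⊡ s) := by rw [interchange, comp_id, id_comp]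
  rw [h, ← id_tensor_scalar, ← scale_def, tensor_id_zero]
  exact (comp_scale s f (id a)).trans (by rw [comp_id])

theorem tensor_scale {a b c d : ℕ} (s : Mor 0 0) (f : Mor a b) (g : Mor c d) :
    f ⊡ (s ◃ g) = s ◃ (f ⊡ g) := by
  rw [← scale_tensor, ← tensor_scalar s f, scale_def, tensor_cast, ← cast_tensor_assoc, cast_cast]
  rfl

theorem scalar_scale (s t : Mor 0 0) : s ◃ t = s ⊙ t := by
  have h := scale_comp s (id 0) t
  rw [id_comp] at h
  rw [← h]
  exact congrArg (· ⊙ t) (tensor_id_zero s)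

/-- The Eckmann–Hilton argument: scaling agrees with composition and passes through either factor.
-/
theorem scalar_comm (s t : Mor 0 0) : s ⊙ t = t ⊙ s := by
  have h := comp_scale s t (id 0)
  rw [comp_id, scalar_scale, scalar_scale, comp_id] at h
  exact h.symm

instance : CommMonoid (Mor 0 0) where
  mul := comp
  mul_assoc := comp_assoc
  one := id 0
  one_mul := id_comp
  mul_one := comp_id
  mul_comm := scalar_comm

theorem scalar_mul (s t : Mor 0 0) : s ◃ t = s * t := scalar_scale s t

theorem one_scale {a b : ℕ} (f : Mor a b) : (1 : Mor 0 0) ◃ f = f := cast_id_zero_tensor f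

theorem scale_scale {a b : ℕ} (s t : Mor 0 0) (f : Mor a b) : s ◃ t ◃ f = (s * t) ◃ f := by
  have h : s * t = s ⊡ t := (scalar_scale s t).symm
  rw [h, scale_def t f, scale_def s, tensor_cast, ← cast_tensor_assoc, cast_cast, cast_cast]
  rfl

/-- Lets equations be proved after multiplication by an invertible scalar, such as a power of
`root`. -/
theorem scale_cancel {a b : ℕ} {s t : Mor 0 0} (h : s * t = 1) {f g : Mor a b}
    (hfg : t ◃ f = t ◃ g) : f = g := by
  rw [← one_scale f, ← one_scale g, ← h, ← scale_scale, ← scale_scale, hfg]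

theorem comp_scalar {b : ℕ} (f : Mor 0 b) (s : Mor 0 0) : f ⊙ s = s ◃ f := by
  have h := comp_scale s f (id 0)
  rw [comp_id, scalar_scale, comp_id] at h
  exact h


/-- The class of a green dot. -/
def z (n m : ℕ) (α : Real.Angle) : Mor n m := mk (Z n m α)

/-- The class of a red dot. -/
def x (n m : ℕ) (α : Real.Angle) : Mor n m := mk (X n m α)

/-- The class of the Hadamard vertex. -/
def h : Mor 1 1 := mk H

/-- The scalar that stands for `√2`. -/
noncomputable def root : Mor 0 0 := x 1 0 0 ⊙ z 0 1 0

/-! ### Elementary rewriting of dots and the Hopf law -/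

theorem id_zero_tensor_state (f : Mor 0 1) : (id 0 ⊡ f : Mor 0 1) = f := cast_id_zero_tensor f

theorem id_zero_tensor_effect (f : Mor 1 0) : (id 0 ⊡ f : Mor 1 0) = f := cast_id_zero_tensor f

theorem id_zero_tensor_wire (f : Mor 1 1) : (id 0 ⊡ f : Mor 1 1) = f := cast_id_zero_tensor f

theorem mk_hadamards_one : mk (hadamards 1) = h := cast_id_zero_tensor h

theorem z_wire : z 1 1 0 = id 1 := (mk_eq (.rule .S2)).trans wire_eq_id

theorem x_wire : x 1 1 0 = id 1 := (mk_eq (.rule_swapped .S2)).trans wire_eq_id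

theorem hadamard_comp_hadamard : h ⊙ h = id 1 := by
  have e : mk (hadamards 1) ⊙ z 1 1 0 ⊙ mk (hadamards 1) = x 1 1 0 := mk_eq (.rule (.H 1 1 0))
  rwa [mk_hadamards_one, z_wire, x_wire, id_comp] at e

theorem x_state (α : Real.Angle) : x 0 1 α = h ⊙ z 0 1 α := by
  have e : mk (hadamards 1) ⊙ z 0 1 α ⊙ id 0 = x 0 1 α := mk_eq (.rule (.H 0 1 α))
  rw [← e, mk_hadamards_one, comp_id]

theorem x_effect (α : Real.Angle) : x 1 0 α = z 1 0 α ⊙ h := by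
  have e : id 0 ⊙ z 1 0 α ⊙ mk (hadamards 1) = x 1 0 α := mk_eq (.rule (.H 1 0 α))
  rw [← e, mk_hadamards_one, id_comp]

theorem x_scalar (α : Real.Angle) : x 0 0 α = z 0 0 α := by
  have e : id 0 ⊙ z 0 0 α ⊙ id 0 = x 0 0 α := mk_eq (.rule (.H 0 0 α))
  rw [← e, id_comp, comp_id]

theorem h_h_comp {a : ℕ} (f : Mor a 1) : h ⊙ h ⊙ f = f := by
  rw [← comp_assoc, hadamard_comp_hadamard, id_comp]

theorem hadamard_x_state (α : Real.Angle) : h ⊙ x 0 1 α = z 0 1 α := by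
  rw [x_state, h_h_comp]

theorem z_x_scalar (α β : Real.Angle) : z 1 0 α ⊙ x 0 1 β = x 1 0 α ⊙ z 0 1 β := by
  rw [x_effect, x_state, comp_assoc]

theorem z_pair : z 0 2 0 = mk eta := mk_eq (.rule .S3)
theorem x_pair : x 0 2 0 = mk eta := mk_eq (.rule_swapped .S3)
theorem z_copair : z 2 0 0 = mk eps := mk_eq (.rule_flipped .S3)
theorem x_copair : x 2 0 0 = mk eps := mk_eq (.rule_swapped_flipped .S3)

theorem root_inv : mk tripleLine * root = 1 := by
  have e : (mk tripleLine ⊡ root : Mor 0 0) = id 0 := mk_eq (.rule .IV)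
  exact (scalar_scale _ _).symm.trans e

theorem x_copies_z : root ◃ (x 1 2 0 ⊙ z 0 1 0) = (z 0 1 0 ⊡ z 0 1 0 : Mor 0 2) := by
  have e : (z 1 0 0 ⊙ x 0 1 0) ◃ (x 1 2 0 ⊙ z 0 1 0) = (z 0 1 0 ⊡ z 0 1 0 : Mor 0 2) :=
    mk_eq (.rule_swapped .B1)
  rwa [z_x_scalar] at e

theorem z_cocopies_x : root ◃ (x 1 0 0 ⊙ z 2 1 0) = (x 1 0 0 ⊡ x 1 0 0 : Mor 2 0) := by
  have e : (z 1 0 0 ⊙ x 0 1 0) ◃ (x 1 0 0 ⊙ z 2 1 0) = (x 1 0 0 ⊡ x 1 0 0 : Mor 2 0) :=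
    mk_eq (.rule_flipped .B1)
  rwa [z_x_scalar] at e

theorem z_z_state (α β : Real.Angle) : z 1 1 β ⊙ z 0 1 α = z 0 1 (α + β) := by
  have e : (id 0 ⊡ z 1 1 β : Mor 1 1) ⊙ (z 0 1 α ⊡ id 0 : Mor 0 1) = z 0 1 (α + β) :=
    -- The last number in `S1` is one less than the number of joining wires.
    mk_eq (.rule (.S1 0 0 0 1 0 α β))
  rwa [id_zero_tensor_wire, tensor_id_zero] at e

theorem x_x_state (α β : Real.Angle) : x 1 1 β ⊙ x 0 1 α = x 0 1 (α + β) := by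
  have e : (id 0 ⊡ x 1 1 β : Mor 1 1) ⊙ (x 0 1 α ⊡ id 0 : Mor 0 1) = x 0 1 (α + β) :=
    mk_eq (.rule_swapped (.S1 0 0 0 1 0 α β))
  rwa [id_zero_tensor_wire, tensor_id_zero] at e

theorem z_effect_state (α β : Real.Angle) : z 1 0 β ⊙ z 0 1 α = z 0 0 (α + β) := by
  have e : (id 0 ⊡ z 1 0 β : Mor 1 0) ⊙ (z 0 1 α ⊡ id 0 : Mor 0 1) = z 0 0 (α + β) :=
    mk_eq (.rule (.S1 0 0 0 0 0 α β))
  rwa [id_zero_tensor_effect, tensor_id_zero] at e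

theorem x_effect_state (α β : Real.Angle) : x 1 0 β ⊙ x 0 1 α = x 0 0 (α + β) := by
  have e : (id 0 ⊡ x 1 0 β : Mor 1 0) ⊙ (x 0 1 α ⊡ id 0 : Mor 0 1) = x 0 0 (α + β) :=
    mk_eq (.rule_swapped (.S1 0 0 0 0 0 α β))
  rwa [id_zero_tensor_effect, tensor_id_zero] at e

theorem z_copair_pair (α : Real.Angle) : z 2 0 0 ⊙ z 0 2 α = z 0 0 α := by
  have e : (id 0 ⊡ z 2 0 0 : Mor 2 0) ⊙ (z 0 2 α ⊡ id 0 : Mor 0 2) = z 0 0 (α + 0) :=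
    mk_eq (.rule (.S1 0 0 0 0 1 α 0))
  rwa [tensor_id_zero, add_zero α, show (id 0 ⊡ z 2 0 0 : Mor 2 0) = z 2 0 0 from
    cast_id_zero_tensor (z 2 0 0)] at e

theorem x_merge_pair : x 2 1 0 ⊙ x 0 2 0 = x 0 1 0 := by
  have e : (id 0 ⊡ x 2 1 0 : Mor 2 1) ⊙ (x 0 2 0 ⊡ id 0 : Mor 0 2) = x 0 1 (0 + 0) :=
    mk_eq (.rule_swapped (.S1 0 0 0 1 1 0 0))
  rwa [tensor_id_zero, add_zero (0 : Real.Angle), show (id 0 ⊡ x 2 1 0 : Mor 2 1) = x 2 1 0 from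
    cast_id_zero_tensor (x 2 1 0)] at e

theorem x_effect_merge : x 1 0 0 ⊙ x 2 1 0 = x 2 0 0 := by
  have e : (id 0 ⊡ x 1 0 0 : Mor 1 0) ⊙ (x 2 1 0 ⊡ id 0 : Mor 2 1) = x 2 0 (0 + 0) :=
    mk_eq (.rule_swapped (.S1 2 0 0 0 0 0 0))
  rwa [id_zero_tensor_effect, tensor_id_zero, add_zero (0 : Real.Angle)] at e

theorem z_copair_state (α : Real.Angle) : z 2 0 0 ⊙ (z 0 1 α ⊡ id 1 : Mor 1 2) = z 1 0 α := by
  have e : (id 0 ⊡ z 2 0 0 : Mor 2 0) ⊙ (z 0 1 α ⊡ id 1 : Mor 1 2) = z 1 0 (α + 0) :=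
    mk_eq (.rule (.S1 0 0 1 0 0 α 0))
  rwa [add_zero α, show (id 0 ⊡ z 2 0 0 : Mor 2 0) = z 2 0 0 from
    cast_id_zero_tensor (z 2 0 0)] at e

theorem x_merge_state (α : Real.Angle) : x 2 1 0 ⊙ (x 0 1 α ⊡ id 1 : Mor 1 2) = x 1 1 α := by
  have e : (id 0 ⊡ x 2 1 0 : Mor 2 1) ⊙ (x 0 1 α ⊡ id 1 : Mor 1 2) = x 1 1 (α + 0) :=
    mk_eq (.rule_swapped (.S1 0 0 1 1 0 α 0))
  rwa [add_zero α, show (id 0 ⊡ x 2 1 0 : Mor 2 1) = x 2 1 0 from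
    cast_id_zero_tensor (x 2 1 0)] at e

theorem states_eq (f g : Mor 0 1) : (f ⊡ g : Mor 0 2) = (f ⊡ id 1 : Mor 1 2) ⊙ g := by
  have e : (f ⊡ id 1 : Mor 1 2) ⊙ (id 0 ⊡ g : Mor 0 1) = (f ⊡ g : Mor 0 2) :=
    (interchange f (id 0) (id 1) g).trans (by rw [comp_id, id_comp])
  rw [← e, id_zero_tensor_state]

theorem z_copair_states (α β : Real.Angle) :
    z 2 0 0 ⊙ (z 0 1 α ⊡ z 0 1 β : Mor 0 2) = z 0 0 (α + β) := by
  rw [states_eq, ← comp_assoc, z_copair_state, z_effect_state, add_comm β α]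

theorem x_merge_states (α β : Real.Angle) :
    x 2 1 0 ⊙ (x 0 1 α ⊡ x 0 1 β : Mor 0 2) = x 0 1 (α + β) := by
  rw [states_eq, ← comp_assoc, x_merge_state, x_x_state, add_comm β α]

theorem z_four (α : Real.Angle) :
    (z 1 2 0 ⊡ z 1 2 0 : Mor 2 4) ⊙ z 0 2 α = z 0 4 α := by
  have e1 : (id 1 ⊡ z 1 2 0 : Mor 2 3) ⊙ (z 0 2 α ⊡ id 0 : Mor 0 2) = z 0 3 (α + 0) :=
    mk_eq (.rule (.S1 0 1 0 2 0 α 0))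
  have e2 : (z 1 2 0 ⊡ id 2 : Mor 3 4) ⊙ (id 0 ⊡ z 0 3 α : Mor 0 3) = z 0 4 (0 + α) :=
    mk_eq (.rule_flipped (.S1 2 0 2 0 0 0 α))
  rw [tensor_id_zero, add_zero α] at e1
  rw [zero_add α, show (id 0 ⊡ z 0 3 α : Mor 0 3) = z 0 3 α from cast_id_zero_tensor (z 0 3 α),
    ← e1, ← comp_assoc, show (z 1 2 0 ⊡ id 2 : Mor 3 4) ⊙ (id 1 ⊡ z 1 2 0 : Mor 2 3) =
      (z 1 2 0 ⊡ z 1 2 0 : Mor 2 4) from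
      (interchange (z 1 2 0) (id 1) (id 2) (z 1 2 0)).trans (by rw [comp_id, id_comp])] at e2
  exact e2

theorem z_four_exchange (α : Real.Angle) :
    mk (wire ⊠ swap ⊠ wire) ⊙ z 0 4 α = z 0 4 α := by
  have e : (id 1 ⊡ mk swap ⊡ id 1 : Mor 4 4) ⊙ z 0 4 α = z 0 4 α :=
    of_topology (.exchange_legs 0 1 1 α)
  rw [← wire_eq_id] at e
  exact e

/-- A red cup is a bent wire, hence also a green cup, and fuses with the green dot, consuming two
legs. -/
theorem copair_merge_z_four (α : Real.Angle) :
    (x 2 0 0 ⊡ x 2 1 0 : Mor 4 1) ⊙ z 0 4 α = x 2 1 0 ⊙ z 0 2 α := by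
  have e1 : (z 2 0 0 ⊡ id 2 : Mor 4 2) ⊙ (id 0 ⊡ z 0 4 α : Mor 0 4) = z 0 2 (0 + α) :=
    mk_eq (.rule_flipped (.S1 0 0 2 0 1 0 α))
  have e2 : (id 0 ⊡ x 2 1 0 : Mor 2 1) ⊙ (z 2 0 0 ⊡ id 2 : Mor 4 2) =
      (z 2 0 0 ⊡ x 2 1 0 : Mor 4 1) :=
    (interchange (id 0) (z 2 0 0) (x 2 1 0) (id 2)).trans (by rw [comp_id, id_comp])
  rw [zero_add α, show (id 0 ⊡ z 0 4 α : Mor 0 4) = z 0 4 α from cast_id_zero_tensor (z 0 4 α)] at e1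
  rw [show (id 0 ⊡ x 2 1 0 : Mor 2 1) = x 2 1 0 from cast_id_zero_tensor (x 2 1 0)] at e2
  rw [x_copair, ← z_copair, ← e2, comp_assoc, e1]

/-- The projector onto the red basis vector of angle `0`. -/
theorem x_effect_copy : root ◃ ((x 1 0 0 ⊡ id 1 : Mor 2 1) ⊙ z 1 2 0) = x 0 1 0 ⊙ x 1 0 0 := by
  have e1 : (z 2 1 0 ⊡ id 1 : Mor 3 2) ⊙ (id 1 ⊡ mk eta : Mor 1 3) = z 1 2 0 := by
    rw [← wire_eq_id]
    refine Eq.trans ?_ (of_topology (.bend_leg 1 1 0))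
    change _ = (z 2 1 0 ⊡ mk wire : Mor 3 2) ⊙ (id 1 ⊡ mk eta : Mor 1 3)
    rw [← wire_eq_id]
  have e2 : (x 1 0 0 ⊡ id 1 : Mor 2 1) ⊙ mk eta = x 0 1 0 := by
    have e : (x 1 0 0 ⊡ mk wire : Mor 2 1) ⊙ (id 0 ⊡ mk eta : Mor 0 2) = x 0 1 0 :=
      mk_eq (.rule_swapped (.topology (.bend_leg 0 0 0)))
    rwa [wire_eq_id, show (id 0 ⊡ mk eta : Mor 0 2) = mk eta from
      cast_id_zero_tensor (mk eta)] at e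
  have e3 : (x 1 0 0 ⊡ id 1 : Mor 2 1) ⊙ (z 2 1 0 ⊡ id 1 : Mor 3 2) =
      ((x 1 0 0 ⊙ z 2 1 0) ⊡ id 1 : Mor 3 1) :=
    (interchange (x 1 0 0) (z 2 1 0) (id 1) (id 1)).trans (by rw [id_comp])
  have e4 : root ◃ ((x 1 0 0 ⊙ z 2 1 0) ⊡ id 1 : Mor 3 1) =
      (x 1 0 0 ⊡ (x 1 0 0 ⊡ id 1 : Mor 2 1) : Mor 3 1) :=
    (scale_tensor root (x 1 0 0 ⊙ z 2 1 0) (id 1)).symm.trans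
      ((congrArg (fun t : Mor 2 0 => (t ⊡ id 1 : Mor 3 1)) z_cocopies_x).trans
        (cast_tensor_assoc (x 1 0 0) (x 1 0 0) (id 1)))
  have e5 : (x 1 0 0 ⊡ (x 1 0 0 ⊡ id 1 : Mor 2 1) : Mor 3 1) ⊙ (id 1 ⊡ mk eta : Mor 1 3) =
      (x 1 0 0 ⊡ x 0 1 0 : Mor 1 1) :=
    (interchange (x 1 0 0) (id 1) (x 1 0 0 ⊡ id 1 : Mor 2 1) (mk eta)).trans
      (by rw [comp_id, e2])
  have e6 : (id 0 ⊡ x 0 1 0 : Mor 0 1) ⊙ (x 1 0 0 ⊡ id 0 : Mor 1 0) =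
      (x 1 0 0 ⊡ x 0 1 0 : Mor 1 1) :=
    (interchange (id 0) (x 1 0 0) (x 0 1 0) (id 0)).trans (by rw [id_comp, comp_id])
  rw [← e1, ← comp_assoc, e3, ← scale_comp, e4, e5, ← e6, tensor_id_zero, id_zero_tensor_state]

/-- Put a red effect on one output of (B2), fed with a green pair. On one side the exchanged legs
fuse back to a green pair under a red dot; on the other the effect is copied and cuts the wire. -/
theorem hopf (α : Real.Angle) : (root * root) ◃ (x 2 1 0 ⊙ z 0 2 α) = z 0 0 α ◃ x 0 1 0 := by
  have b2 : root ◃ ((x 2 1 0 ⊡ x 2 1 0 : Mor 4 2) ⊙ mk (wire ⊠ swap ⊠ wire) ⊙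
      (z 1 2 0 ⊡ z 1 2 0 : Mor 2 4)) = z 1 2 0 ⊙ x 2 1 0 := mk_eq (.rule .B2)
  have e1 : (x 1 0 0 ⊡ id 1 : Mor 2 1) ⊙ (x 2 1 0 ⊡ x 2 1 0 : Mor 4 2) =
      (x 2 0 0 ⊡ x 2 1 0 : Mor 4 1) :=
    (interchange (x 1 0 0) (x 2 1 0) (id 1) (x 2 1 0)).trans (by rw [id_comp, x_effect_merge])
  have e2 : (x 1 0 0 ⊡ id 1 : Mor 2 1) ⊙ (z 1 2 0 ⊙ x 2 1 0) ⊙ z 0 2 α =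
      root ◃ (x 2 1 0 ⊙ z 0 2 α) := by
    rw [← b2, scale_comp, comp_scale, comp_assoc, comp_assoc, z_four, z_four_exchange,
      ← comp_assoc, e1, copair_merge_z_four]
  rw [← scale_scale, ← e2, ← comp_assoc, ← comp_assoc, ← scale_comp, ← scale_comp, x_effect_copy,
    comp_assoc, comp_assoc, ← comp_assoc (x 1 0 0) (x 2 1 0), x_effect_merge, x_copair, ← z_copair,
    z_copair_pair, comp_scalar]


/-! ### The angle zero -/

theorem z_scalar_zero : z 0 0 0 = root * root := by
  have e1 : x 2 0 0 ⊙ x 1 2 0 = x 1 0 0 := by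
    have e : (id 0 ⊡ x 2 0 0 : Mor 2 0) ⊙ (x 1 2 0 ⊡ id 0 : Mor 1 2) = x 1 0 (0 + 0) :=
      mk_eq (.rule_swapped (.S1 1 0 0 0 1 0 0))
    rwa [tensor_id_zero, add_zero (0 : Real.Angle), show (id 0 ⊡ x 2 0 0 : Mor 2 0) = x 2 0 0 from
      cast_id_zero_tensor (x 2 0 0)] at e
  have e2 := z_copair_states 0 0
  rw [← x_copies_z, comp_scale, z_copair, ← x_copair, ← comp_assoc, e1, add_zero (0 : Real.Angle)] at e2
  exact e2.symm.trans (scalar_mul _ _)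

/-- The red dot copies the green state: one copy leaves as output, the other closes off `f` into a
scalar. -/
theorem x_merge_z (f : Mor 0 1) : root ◃ (x 2 1 0 ⊙ (z 0 1 0 ⊡ f : Mor 0 2)) =
    (z 2 0 0 ⊙ (z 0 1 0 ⊡ f : Mor 0 2)) ◃ z 0 1 0 := by
  have e1 : (id 1 ⊡ mk eps : Mor 3 1) ⊙ (x 1 2 0 ⊡ id 1 : Mor 2 3) = x 2 1 0 := by
    have e : (id 1 ⊡ mk eps : Mor 3 1) ⊙ (x 1 2 0 ⊡ mk wire : Mor 2 3) = x 2 1 0 :=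
      mk_eq (.rule_swapped_flipped (.topology (.bend_leg 1 1 0)))
    rwa [wire_eq_id] at e
  have e2 : (x 1 2 0 ⊡ id 1 : Mor 2 3) ⊙ (z 0 1 0 ⊡ f : Mor 0 2) =
      ((x 1 2 0 ⊙ z 0 1 0) ⊡ f : Mor 0 3) :=
    (interchange (x 1 2 0) (z 0 1 0) (id 1) f).trans (by rw [id_comp])
  have e3 : root ◃ ((x 1 2 0 ⊙ z 0 1 0) ⊡ f : Mor 0 3) =
      (z 0 1 0 ⊡ (z 0 1 0 ⊡ f : Mor 0 2) : Mor 0 3) :=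
    (scale_tensor root (x 1 2 0 ⊙ z 0 1 0) f).symm.trans
      ((congrArg (fun t : Mor 0 2 => (t ⊡ f : Mor 0 3)) x_copies_z).trans
        (cast_tensor_assoc (z 0 1 0) (z 0 1 0) f))
  have e4 : (id 1 ⊡ mk eps : Mor 3 1) ⊙ (z 0 1 0 ⊡ (z 0 1 0 ⊡ f : Mor 0 2) : Mor 0 3) =
      z 0 1 0 ⊡ (mk eps ⊙ (z 0 1 0 ⊡ f : Mor 0 2)) :=
    (interchange (id 1) (z 0 1 0) (mk eps) (z 0 1 0 ⊡ f : Mor 0 2)).trans (by rw [id_comp])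
  rw [← e1, comp_assoc, e2, ← comp_scale, e3, e4, tensor_scalar, z_copair]

theorem zero_cut : z 0 0 (Real.pi : ℝ) ◃ id 1 = z 0 0 (Real.pi : ℝ) ◃ (x 0 1 0 ⊙ z 1 0 0) := by
  have e : z 0 0 (Real.pi : ℝ) ◃ mk wire = z 0 0 (Real.pi : ℝ) ◃ (x 0 1 0 ⊙ z 1 0 0) :=
    mk_eq (.rule .ZO)
  rwa [wire_eq_id] at e

theorem zero_z_state :
    z 0 0 (Real.pi : ℝ) ◃ z 0 1 0 = (z 0 0 (Real.pi : ℝ) * (root * root)) ◃ x 0 1 0 := by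
  have e := congrArg (· ⊙ z 0 1 0) zero_cut
  simp only [scale_comp] at e
  rwa [id_comp, comp_assoc, z_effect_state, add_zero (0 : Real.Angle), z_scalar_zero, comp_scalar,
    scale_scale] at e

/-- The effect `x 1 0 0` applied to `zero_z_state`. The zero scalar thus absorbs `root ^ 3`, which
balances the two sides of supplementarity. -/
theorem zero_mul_root :
    z 0 0 (Real.pi : ℝ) * root = z 0 0 (Real.pi : ℝ) * (root * root * (root * root)) := by
  have e := congrArg (x 1 0 0 ⊙ ·) zero_z_state
  simp only [comp_scale] at e
  rw [x_effect_state, add_zero (0 : Real.Angle), x_scalar, z_scalar_zero, scalar_mul,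
    scalar_mul, mul_assoc] at e
  exact e

theorem root_inv_pow (n : ℕ) : mk tripleLine ^ n * root ^ n = 1 := by
  rw [← mul_pow, root_inv, one_pow]

theorem supplementarity_zero :
    x 2 1 0 ⊙ (z 0 1 0 ⊡ z 0 1 (Real.pi : ℝ) : Mor 0 2) = x 2 1 0 ⊙ z 0 2 (Real.pi : ℝ) := by
  -- Copying costs one `root` and the Hopf law two, so the third power serves both sides.
  apply scale_cancel (root_inv_pow 3)
  have hl : root ^ 3 = (root * root) * root := by rw [pow_succ, pow_two]
  have hr : root ^ 3 = root * (root * root) := by rw [hl, mul_comm]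
  conv_lhs => rw [hl, ← scale_scale, x_merge_z, z_copair_states, zero_add (Real.Angle.coe _),
    zero_z_state, scale_scale]
  rw [hr, ← scale_scale root (root * root), hopf, scale_scale, mul_comm root (z 0 0 _), zero_mul_root]
  congr 1
  ac_rfl

/-! ### The right angle -/

theorem x_wire_z_state (α : Real.Angle) :
    root ◃ (x 1 1 α ⊙ z 0 1 0) = (x 1 0 α ⊙ z 0 1 0) ◃ z 0 1 0 := by
  have e1 : (x 1 0 α ⊡ id 1 : Mor 2 1) ⊙ (id 0 ⊡ x 1 2 0 : Mor 1 2) = x 1 1 (α + 0) :=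
    mk_eq (.rule_swapped_flipped (.S1 0 0 1 1 0 α 0))
  have e2 : (x 1 0 α ⊡ id 1 : Mor 2 1) ⊙ (z 0 1 0 ⊡ z 0 1 0 : Mor 0 2) =
      (x 1 0 α ⊙ z 0 1 0) ◃ z 0 1 0 :=
    (interchange (x 1 0 α) (z 0 1 0) (id 1) (z 0 1 0)).trans (by rw [id_comp]; rfl)
  rw [add_zero α, show (id 0 ⊡ x 1 2 0 : Mor 1 2) = x 1 2 0 from
    cast_id_zero_tensor (x 1 2 0)] at e1
  rw [← e1, comp_assoc, ← comp_scale, x_copies_z, e2]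

/-- The right angle. -/
noncomputable def quarter : Real.Angle := (Real.pi / 2 : ℝ)

/-- The scalar that relates green and red states of right angles. -/
noncomputable def eulerScalar : Mor 0 0 := z 0 0 (-quarter) * (x 1 0 quarter ⊙ z 0 1 0)

/-- Apply (EU) to the green state of angle `-π/2`: the first green dot cancels the angle, the red
dot passes the resulting state up to a scalar, and the last green dot adds `π/2`. -/
theorem x_state_eq : (root * root) ◃ x 0 1 (-quarter) = eulerScalar ◃ z 0 1 quarter := by
  have e : root ◃ h = z 0 0 (-(Real.pi / 2) : ℝ) ◃
      (z 1 1 quarter ⊙ x 1 1 quarter ⊙ z 1 1 quarter) := mk_eq (.rule .EU)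
  rw [Real.Angle.coe_neg] at e
  change root ◃ h = z 0 0 (-quarter) ◃ _ at e
  rw [← scale_scale, x_state, ← scale_comp, e, scale_comp, comp_assoc, comp_assoc, z_z_state,
    neg_add_cancel, scale_scale, mul_comm, ← scale_scale, ← comp_scale, x_wire_z_state,
    comp_scale, z_z_state, zero_add quarter, scale_scale, eulerScalar]

theorem z_state_eq : (root * root) ◃ z 0 1 (-quarter) = eulerScalar ◃ x 0 1 quarter := by
  have e := congrArg (h ⊙ ·) x_state_eq
  simp only [comp_scale] at e
  rwa [hadamard_x_state, ← x_state] at e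

theorem eulerScalar_inv : ∃ t, t * (eulerScalar * (root * root)) = 1 := by
  have e := congrArg (x 1 0 quarter ⊙ ·) x_state_eq
  simp only [comp_scale] at e
  rw [x_effect_state, neg_add_cancel, x_scalar, z_scalar_zero, scalar_mul, scalar_mul] at e
  -- By `e`, the second factor times `eulerScalar` is `root ^ 4`; the extra `root * root` makes six.
  refine ⟨mk tripleLine ^ 6 * (x 1 0 quarter ⊙ z 0 1 quarter), ?_⟩
  rw [← root_inv_pow 6, show root ^ 6 = (root * root * (root * root)) * (root * root) by
    simp only [pow_succ, pow_zero, one_mul, mul_assoc], e]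
  ac_rfl

/-- Both green states are proportional to red ones of opposite angles, which cancel in the red dot.
-/
theorem x_merge_z_states :
    x 2 1 0 ⊙ (z 0 1 quarter ⊡ z 0 1 (-quarter) : Mor 0 2) = x 0 1 0 := by
  obtain ⟨t, ht⟩ := eulerScalar_inv
  apply scale_cancel ht
  have e : eulerScalar ◃ (root * root) ◃ (z 0 1 quarter ⊡ z 0 1 (-quarter) : Mor 0 2) =
      (root * root) ◃ eulerScalar ◃ (x 0 1 (-quarter) ⊡ x 0 1 quarter : Mor 0 2) :=
    (congrArg (eulerScalar ◃ ·) (tensor_scale ((root * root)) (z 0 1 quarter) (z 0 1 (-quarter))).symm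
      |>.trans <| (scale_tensor eulerScalar (z 0 1 quarter) ((root * root) ◃ z 0 1 (-quarter))).symm).trans
    ((by rw [x_state_eq, z_state_eq] :
      (eulerScalar ◃ z 0 1 quarter) ⊡ ((root * root) ◃ z 0 1 (-quarter)) =
        ((root * root) ◃ x 0 1 (-quarter)) ⊡ (eulerScalar ◃ x 0 1 quarter)).trans
    ((scale_tensor ((root * root)) (x 0 1 (-quarter)) (eulerScalar ◃ x 0 1 quarter)).trans
      (congrArg ((root * root) ◃ ·) (tensor_scale eulerScalar (x 0 1 (-quarter)) (x 0 1 quarter)))))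
  rw [← scale_scale, ← comp_scale, ← comp_scale, e, comp_scale, comp_scale, x_merge_states,
    neg_add_cancel, scale_scale, mul_comm]

theorem swap_states (f g : Mor 0 1) : mk swap ⊙ (f ⊡ g : Mor 0 2) = (g ⊡ f : Mor 0 2) := by
  have e : mk swap ⊙ (f ⊡ id 1 : Mor 1 2) = (id 1 ⊡ f : Mor 1 2) := by
    induction f using Quotient.inductionOn with
    | _ f =>
      have e := of_topology (.slide_natural f)
      change ((mk wire ⊡ mk wire : Mor 2 2) ⊙ (id 0 ⊡ mk swap : Mor 2 2)) ⊙
        (mk f ⊡ mk wire : Mor 1 2) = (mk wire ⊡ mk f : Mor 1 2) ⊙ mk wire at e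
      rw [wire_eq_id, show (id 0 ⊡ mk swap : Mor 2 2) = mk swap from
        cast_id_zero_tensor (mk swap), comp_id] at e
      refine Eq.trans ?_ e
      have e' : (id 1 ⊡ id 1 : Mor 2 2) = id 2 := by
        rw [← wire_eq_id, wire_eq_id]
        exact (congrArg (fun t : Mor 1 1 => (id 1 ⊡ t : Mor 2 2)) wire_eq_id).symm
      rw [e', id_comp]
      rfl
  have e2 : (id 1 ⊡ f : Mor 1 2) ⊙ (g ⊡ id 0 : Mor 0 1) = (g ⊡ f : Mor 0 2) :=
    (interchange (id 1) g f (id 0)).trans (by rw [comp_id, id_comp])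
  rw [states_eq, ← comp_assoc, e, ← e2, tensor_id_zero]

theorem x_merge_comm (f g : Mor 0 1) :
    x 2 1 0 ⊙ (f ⊡ g : Mor 0 2) = x 2 1 0 ⊙ (g ⊡ f : Mor 0 2) := by
  have e : x 2 1 0 ⊙ (id 0 ⊡ (mk swap ⊡ id 0 : Mor 2 2) : Mor 2 2) = x 2 1 0 :=
    mk_eq (.rule_swapped_flipped (.topology (.exchange_legs 1 0 0 0)))
  rw [tensor_id_zero, show (id 0 ⊡ mk swap : Mor 2 2) = mk swap from
    cast_id_zero_tensor (mk swap)] at e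
  rw [← swap_states, ← comp_assoc, e]

end Mor

/-! ### All multiples of the right angle -/

open Mor

theorem derivable_supp_iff (α : Real.Angle) : Derivable (suppLeft α) (suppRight α) ↔
    x 2 1 0 ⊙ (z 0 1 α ⊡ z 0 1 (α + (Real.pi : ℝ)) : Mor 0 2) =
      x 2 1 0 ⊙ z 0 2 (α + α + (Real.pi : ℝ)) :=
  mk_eq_iff.symm

/-- The shift exchanges the two green states and leaves `2α + π` fixed. -/
theorem derivable_supp_add_pi {α : Real.Angle} (h : Derivable (suppLeft α) (suppRight α)) :
    Derivable (suppLeft (α + (Real.pi : ℝ))) (suppRight (α + (Real.pi : ℝ))) := by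
  rw [derivable_supp_iff] at h ⊢
  have e : α + (Real.pi : ℝ) + (Real.pi : ℝ) = α := by
    rw [add_assoc, Real.Angle.coe_pi_add_coe_pi, add_zero]
  have e' : α + (Real.pi : ℝ) + (α + (Real.pi : ℝ)) + (Real.pi : ℝ) = α + α + (Real.pi : ℝ) := by
    rw [add_add_add_comm, Real.Angle.coe_pi_add_coe_pi, add_zero]
  rw [e, e', x_merge_comm, h]

theorem derivable_supp_zero : Derivable (suppLeft 0) (suppRight 0) := by
  rw [derivable_supp_iff, add_zero (0 : Real.Angle), zero_add (Real.Angle.coe _)]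
  exact supplementarity_zero

theorem derivable_supp_quarter : Derivable (suppLeft quarter) (suppRight quarter) := by
  have e1 : quarter + quarter = (Real.pi : ℝ) := by
    rw [quarter, ← Real.Angle.coe_add, add_halves]
  have e2 : quarter + (Real.pi : ℝ) = -quarter := by
    rw [eq_neg_iff_add_eq_zero, add_right_comm, e1, Real.Angle.coe_pi_add_coe_pi]
  -- Here `2α + π = 0`, so the green pair is a bare bent wire and may be read as red.
  rw [derivable_supp_iff, e2, e1, Real.Angle.coe_pi_add_coe_pi, x_merge_z_states, z_pair, ← x_pair,
    x_merge_pair]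

theorem derivable_of_multiple (k : ℤ) :
    Derivable (suppLeft ((k * (Real.pi / 2) : ℝ) : Real.Angle))
      (suppRight ((k * (Real.pi / 2) : ℝ) : Real.Angle)) := by
  have red : ((k * (Real.pi / 2) : ℝ) : Real.Angle) = (((k % 4 : ℤ) * (Real.pi / 2) : ℝ)) := by
    rw [Real.Angle.angle_eq_iff_two_pi_dvd_sub]
    refine ⟨k / 4, ?_⟩
    have := congrArg (Int.cast : ℤ → ℝ) (Int.emod_add_mul_ediv k 4)
    push_cast at this
    linear_combination (-Real.pi / 2) * this
  rw [red]
  have h0 := Int.emod_nonneg k (by norm_num : (4 : ℤ) ≠ 0)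
  have h4 := Int.emod_lt_of_pos k (by norm_num : (0 : ℤ) < 4)
  generalize k % 4 = r at h0 h4
  interval_cases r
  · simpa using derivable_supp_zero
  · simpa [quarter] using derivable_supp_quarter
  · have e : (((2 : ℤ) * (Real.pi / 2) : ℝ) : Real.Angle) = 0 + (Real.pi : ℝ) := by
      rw [zero_add]
      congr 1
      push_cast
      ring
    rw [e]
    exact derivable_supp_add_pi derivable_supp_zero
  · have e : (((3 : ℤ) * (Real.pi / 2) : ℝ) : Real.Angle) = quarter + (Real.pi : ℝ) := by
      rw [quarter, ← Real.Angle.coe_add]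
      congr 1
      push_cast
      ring
    rw [e]
    exact derivable_supp_add_pi derivable_supp_quarter

end ZX

theorem theorem2 (α : ℝ) :
    ZX.Derivable (ZX.suppLeft (α : Real.Angle)) (ZX.suppRight (α : Real.Angle)) ↔
      ∃ k : ℤ, α = k * (Real.pi / 2) := by
  refine ⟨ZX.multiple_of_derivable α, ?_⟩
  rintro ⟨k, rfl⟩
  exact ZX.derivable_of_multiple k
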